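/- **Theorem 5.2 (Gelfand–Zetlin type representation of $M_{q\tilde q}(\mathfrak{gl}(N))$).** Let $\omega_1,\omega_2$ be nonzero complex numbers, and let $q=e^{\pi i\omega_1/\omega_2}$, $\tilde q=e^{\pi i\omega_2/\omega_1}$ satisfy $q^2\neq1$, $\tilde q^2\neq 1$ (for instance $\omega_1,\omega_2$ real with $\omega_1/\omega_2$ irrational). *The algebra.* $U_q(\mathfrak{gl}(N))$ is the unital associative $\mathbb C$-algebra generated by invertible, pairwise commuting elements $K_n$ $(1\le n\le N)$ and by $E_{n,n+1}$, $E_{n+1,n}$ $(1\le n\le N-1)$ subject to $$E_{n,n+1}E_{m+1,m}-E_{m+1,m}E_{n,n+1}=\delta_{nm}\frac{K_nK_{n+1}^{-1}-K_n^{-1}K_{n+1}}{q-q^{-1}},$$ $$K_nE_{m,m+1}=q^{\delta_{nm}-\delta_{n,m+1}}E_{m,m+1}K_n,\qquad K_nE_{m+1,m}=q^{\delta_{n,m+1}-\delta_{nm}}E_{m+1,m}K_n,$$ and, both for $X_n=E_{n,n+1}$ and for $X_n=E_{n+1,n}$, the Serre relations $X_nX_m=X_mX_n$ for $m\ne n\pm1$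 and $X_n^2X_m-(q+q^{-1})X_nX_mX_n+X_mX_n^2=0$ for $m=n\pm1$. The modular double $M_{q\tilde q}(\mathfrak{gl}(N))$ is the algebra generated by the generators of $U_q(\mathfrak{gl}(N))$ and the generators $\tilde K_n,\tilde E_{n,n+1},\tilde E_{n+1,n}$ of $U_{\tilde q}(\mathfrak{gl}(N))$, each family satisfying its own relations, together with the cross-relations $$K_n\tilde K_m=\tilde K_mK_n,$$ $$E_{n,n+1}\tilde K_m=(-1)^{\delta_{nm}+\delta_{n,m-1}}\tilde K_mE_{n,n+1},\qquad E_{n+1,n}\tilde K_m=(-1)^{\delta_{nm}+\delta_{n,m-1}}\tilde K_mE_{n+1,n},$$ $$\tilde E_{n,n+1}K_m=(-1)^{\delta_{nm}+\delta_{n,m-1}}K_m\tilde E_{n,n+1},\qquad \tilde E_{n+1,n}K_m=(-1)^{\delta_{nm}+\delta_{n,m-1}}K_m\tilde E_{n+1,n},$$ $$E_{n,n+1}\tilde E_{m,m+1}=(-1)^{\delta_{n,m+1}+\delta_{n+1,m}}\tilde E_{m,m+1}E_{n,n+1},\qquad E_{n+1,n}\tilde E_{m+1,m}=(-1)^{\delta_{n,m-1}+\delta_{n-1,m}}\tilde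 E_{m+1,m}E_{n+1,n},$$ $$E_{n,n+1}\tilde E_{m+1,m}=\tilde E_{m+1,m}E_{n,n+1},\qquad \tilde E_{n,n+1}E_{m+1,m}=E_{m+1,m}\tilde E_{n,n+1}.$$ *The space.* Fix arbitrary parameters $\gamma_{N1},\dots,\gamma_{NN}\in\mathbb C$, and let $\mathcal M$ be the space of meromorphic functions on $\mathbb C^{N(N-1)/2}$ in the variables $\gamma_{nj}$, $1\le j\le n\le N-1$. Here $e^{a\partial_{\gamma_{nj}}}$ denotes the shift $\gamma_{nj}\mapsto\gamma_{nj}+a$ acting on $\mathcal M$. *The claim.* The following operators on $\mathcal M$ define a representation of the algebra $M_{q\tilde q}(\mathfrak{gl}(N))$: $$E_{n,n+1}=\frac{2e^{\frac{\pi i(\omega_1+\omega_2)(n-1)}{2\omega_2}}}{q-q^{-1}}\sum_{j=1}^n\frac{\prod_{r=1}^{n+1}\sinh\frac{\pi}{\omega_2}\bigl(\gamma_{nj}-\gamma_{n+1,r}-\frac i2(\omega_1+\omega_2)\bigr)}{\prod_{s\ne j}\sinh\frac{\pi}{\omega_2}(\gamma_{nj}-\gamma_{ns})}\,e^{-i\omega_1\partial_{\gamma_{nj}}},$$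 $$E_{n+1,n}=\frac{2e^{-\frac{\pi i(\omega_1+\omega_2)(n-1)}{2\omega_2}}}{q-q^{-1}}\sum_{j=1}^n\frac{\prod_{r=1}^{n-1}\sinh\frac{\pi}{\omega_2}\bigl(\gamma_{nj}-\gamma_{n-1,r}+\frac i2(\omega_1+\omega_2)\bigr)}{\prod_{s\ne j}\sinh\frac{\pi}{\omega_2}(\gamma_{nj}-\gamma_{ns})}\,e^{i\omega_1\partial_{\gamma_{nj}}},$$ $$K_n=e^{\frac{\pi}{\omega_2}\left(\sum_{j=1}^n\gamma_{nj}-\sum_{j=1}^{n-1}\gamma_{n-1,j}\right)},$$ with $\tilde E_{n,n+1},\tilde E_{n+1,n},\tilde K_n$ given by the same formulas with $\omega_1$ and $\omega_2$ interchanged (hence $q$ replaced by $\tilde q$). -/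

import Mathlib

noncomputable section

/-! ## Meromorphic functions on `ℂ^ι` -/

/-- The algebra of entire functions on `ℂ^ι`. -/
def EntireFn (ι : Type) [Fintype ι] : Subalgebra ℂ ((ι → ℂ) → ℂ) where
  carrier := {f | AnalyticOnNhd ℂ f Set.univ}
  mul_mem' hf hg := hf.mul hg
  add_mem' hf hg := hf.add hg
  algebraMap_mem' _ := analyticOnNhd_const

theorem EntireFn.eq_zero_or_eq_zero {ι : Type} [Fintype ι] (f g : EntireFn ι)
    (h : f * g = 0) : f = 0 ∨ g = 0 := by
  by_contra! hc
  obtain ⟨hf, hg⟩ := hc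
  have hx : ∃ x, f.1 x ≠ 0 := by
    by_contra! hx
    exact hf (Subtype.ext (funext hx))
  obtain ⟨x, hx⟩ := hx
  have hne : ∀ᶠ y in nhds x, f.1 y ≠ 0 :=
    (f.2 x (Set.mem_univ x)).continuousAt.eventually_ne hx
  have hg0 : g.1 =ᶠ[nhds x] 0 := by
    filter_upwards [hne] with y hy
    have h' : f.1 y * g.1 y = 0 := congrFun (congrArg Subtype.val h) y
    exact (mul_eq_zero.mp h').resolve_left hy
  have hA : AnalyticOnNhd ℂ g.1 Set.univ := g.2
  have h0 := hA.eqOn_zero_of_preconnected_of_eventuallyEq_zero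
    isPreconnected_univ (Set.mem_univ x) hg0
  exact hg (Subtype.ext (funext fun y => h0 (Set.mem_univ y)))

instance (ι : Type) [Fintype ι] : NoZeroDivisors (EntireFn ι) where
  eq_zero_or_eq_zero_of_mul_eq_zero {a b} h := EntireFn.eq_zero_or_eq_zero a b h

instance (ι : Type) [Fintype ι] : IsDomain (EntireFn ι) := NoZeroDivisors.to_isDomain _

/-- The field of meromorphic functions on `ℂ^ι`: since every global meromorphic function on `ℂ^ι`
is a quotient of two entire functions, this is the fraction field of the entire functions. -/
abbrev MerFn (ι : Type) [Fintype ι] : Type := FractionRing (EntireFn ι)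

namespace EntireFn

variable {ι : Type} [Fintype ι]

/-- The coordinate function `x ↦ x i`. -/
def coord (i : ι) : EntireFn ι :=
  ⟨fun x => x i, (ContinuousLinearMap.proj (R := ℂ) (φ := fun _ : ι => ℂ) i).analyticOnNhd _⟩

/-- The constant function. -/
def const (a : ℂ) : EntireFn ι := algebraMap ℂ (EntireFn ι) a

/-- `x ↦ exp (f x)`. -/
def exp (f : EntireFn ι) : EntireFn ι :=
  ⟨fun x => Complex.exp (f.1 x), AnalyticOnNhd.cexp f.2⟩

/-- `x ↦ sinh (f x)`. -/
def sinh (f : EntireFn ι) : EntireFn ι :=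
  ⟨fun x => Complex.sinh (f.1 x), fun x hx =>
    (Complex.differentiable_sinh.analyticAt (f.1 x)).comp (f.2 x hx)⟩

/-- Translation of entire functions, `f ↦ (x ↦ f (x + v))`. -/
def translate (v : ι → ℂ) : EntireFn ι ≃ₐ[ℂ] EntireFn ι where
  toFun f := ⟨fun x => f.1 (x + v), fun x _ =>
    AnalyticAt.fun_comp (f.2 (x + v) (Set.mem_univ _)) (analyticAt_id.add analyticAt_const)⟩
  invFun f := ⟨fun x => f.1 (x - v), fun x _ =>
    AnalyticAt.fun_comp (f.2 (x - v) (Set.mem_univ _)) (analyticAt_id.sub analyticAt_const)⟩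
  left_inv f := Subtype.ext (funext fun x => congrArg f.1 (sub_add_cancel x v))
  right_inv f := Subtype.ext (funext fun x => congrArg f.1 (add_sub_cancel_right x v))
  map_mul' _ _ := rfl
  map_add' _ _ := rfl
  commutes' _ := rfl

end EntireFn

namespace MerFn

variable {ι : Type} [Fintype ι]

/-- An entire function regarded as a meromorphic function. -/
def ofEntire (f : EntireFn ι) : MerFn ι := algebraMap (EntireFn ι) (MerFn ι) f

/-- The translation operator `f ↦ (x ↦ f (x + v))` on meromorphic functions. -/
def translate (v : ι → ℂ) : Module.End ℂ (MerFn ι) :=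
  (IsFractionRing.algEquivOfAlgEquiv (K := MerFn ι) (L := MerFn ι)
    (EntireFn.translate v)).toLinearMap

/-- The operator of multiplication by a meromorphic function. -/
def mulOp (a : MerFn ι) : Module.End ℂ (MerFn ι) := LinearMap.mulLeft ℂ a

end MerFn

/-! ## The modular double of `gl(N)`

Indices are shifted by one: `n : Fin N` stands for the index `n + 1 ∈ {1, …, N}`, and
`n : Fin (N - 1)` for the index `n + 1 ∈ {1, …, N - 1}`. -/

/-- Generators of `U_q(gl(N))`: `K n` is `K_{n+1}`, `Kinv n` is its inverse, `E n` is
`E_{n+1,n+2}` and `F n` is `E_{n+2,n+1}`. -/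
inductive UqglGen (N : ℕ) : Type
  | K (n : Fin N)
  | Kinv (n : Fin N)
  | E (n : Fin (N - 1))
  | F (n : Fin (N - 1))

/-- The index `n` of `{1, …, N-1}` as an index in `{1, …, N}`. -/
def idxLo {N : ℕ} (n : Fin (N - 1)) : Fin N := ⟨n.val, by omega⟩

/-- The index `n + 1` in `{1, …, N}`, for `n` in `{1, …, N-1}`. -/
def idxHi {N : ℕ} (n : Fin (N - 1)) : Fin N := ⟨n.val + 1, by omega⟩

/-- Kronecker's symbol. -/
def kron (a b : ℕ) : ℕ := if a = b then 1 else 0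

/-- The defining relations of `U_q(gl(N))`, for elements `K`, `Kinv`, `E`, `F` of an algebra. -/
inductive UqglRel {A : Type} [Ring A] [Algebra ℂ A] (N : ℕ) (q : ℂ)
    (K Kinv : Fin N → A) (E F : Fin (N - 1) → A) : A → A → Prop
  | K_mul_Kinv (n : Fin N) : UqglRel N q K Kinv E F (K n * Kinv n) 1
  | Kinv_mul_K (n : Fin N) : UqglRel N q K Kinv E F (Kinv n * K n) 1
  | K_comm (n m : Fin N) : UqglRel N q K Kinv E F (K n * K m) (K m * K n)
  | E_F_same (n : Fin (N - 1)) :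
      UqglRel N q K Kinv E F (E n * F n - F n * E n)
        ((q - q⁻¹)⁻¹ • (K (idxLo n) * Kinv (idxHi n) - Kinv (idxLo n) * K (idxHi n)))
  | E_F_ne (n m : Fin (N - 1)) (h : n ≠ m) :
      UqglRel N q K Kinv E F (E n * F m - F m * E n) 0
  | K_E (n : Fin N) (m : Fin (N - 1)) :
      UqglRel N q K Kinv E F (K n * E m)
        (q ^ ((kron n.val m.val : ℤ) - (kron n.val (m.val + 1) : ℤ)) • (E m * K n))
  | K_F (n : Fin N) (m : Fin (N - 1)) :
      UqglRel N q K Kinv E F (K n * F m)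
        (q ^ ((kron n.val (m.val + 1) : ℤ) - (kron n.val m.val : ℤ)) • (F m * K n))
  | E_comm (n m : Fin (N - 1)) (h : m.val ≠ n.val + 1) (h' : n.val ≠ m.val + 1) :
      UqglRel N q K Kinv E F (E n * E m - E m * E n) 0
  | E_serre (n m : Fin (N - 1)) (h : m.val = n.val + 1 ∨ n.val = m.val + 1) :
      UqglRel N q K Kinv E F
        (E n ^ 2 * E m - (q + q⁻¹) • (E n * E m * E n) + E m * E n ^ 2) 0
  | F_comm (n m : Fin (N - 1)) (h : m.val ≠ n.val + 1) (h' : n.val ≠ m.val + 1) :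
      UqglRel N q K Kinv E F (F n * F m - F m * F n) 0
  | F_serre (n m : Fin (N - 1)) (h : m.val = n.val + 1 ∨ n.val = m.val + 1) :
      UqglRel N q K Kinv E F
        (F n ^ 2 * F m - (q + q⁻¹) • (F n * F m * F n) + F m * F n ^ 2) 0

/-- The cross-relations between two families of generators. -/
inductive CrossRel {A : Type} [Ring A] [Algebra ℂ A] (N : ℕ)
    (K : Fin N → A) (E F : Fin (N - 1) → A) (K' : Fin N → A) (E' F' : Fin (N - 1) → A) :
    A → A → Prop
  | K_K' (n m : Fin N) : CrossRel N K E F K' E' F' (K n * K' m) (K' m * K n)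
  | E_K' (n : Fin (N - 1)) (m : Fin N) :
      CrossRel N K E F K' E' F' (E n * K' m)
        ((-1 : ℂ) ^ (kron n.val m.val + kron (n.val + 1) m.val) • (K' m * E n))
  | F_K' (n : Fin (N - 1)) (m : Fin N) :
      CrossRel N K E F K' E' F' (F n * K' m)
        ((-1 : ℂ) ^ (kron n.val m.val + kron (n.val + 1) m.val) • (K' m * F n))
  | E_E' (n m : Fin (N - 1)) :
      CrossRel N K E F K' E' F' (E n * E' m)
        ((-1 : ℂ) ^ (kron n.val (m.val + 1) + kron (n.val + 1) m.val) • (E' m * E n))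
  | E_F' (n m : Fin (N - 1)) : CrossRel N K E F K' E' F' (E n * F' m) (F' m * E n)
  | F_F' (n m : Fin (N - 1)) :
      CrossRel N K E F K' E' F' (F n * F' m)
        ((-1 : ℂ) ^ (kron (n.val + 1) m.val + kron n.val (m.val + 1)) • (F' m * F n))
  | E'_K (n : Fin (N - 1)) (m : Fin N) :
      CrossRel N K E F K' E' F' (E' n * K m)
        ((-1 : ℂ) ^ (kron n.val m.val + kron (n.val + 1) m.val) • (K m * E' n))
  | F'_K (n : Fin (N - 1)) (m : Fin N) :
      CrossRel N K E F K' E' F' (F' n * K m)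
        ((-1 : ℂ) ^ (kron n.val m.val + kron (n.val + 1) m.val) • (K m * F' n))
  | E'_F (n m : Fin (N - 1)) : CrossRel N K E F K' E' F' (E' n * F m) (F m * E' n)

/-- The free algebra on the generators of `U_q(gl(N))` (left summand) and of
`U_{q̃}(gl(N))` (right summand). -/
abbrev ModularFree (N : ℕ) : Type := FreeAlgebra ℂ (UqglGen N ⊕ UqglGen N)

/-- A generator of the first copy in the free algebra. -/
def freeL {N : ℕ} (g : UqglGen N) : ModularFree N := FreeAlgebra.ι ℂ (Sum.inl g)

/-- A generator of the second copy in the free algebra. -/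
def freeR {N : ℕ} (g : UqglGen N) : ModularFree N := FreeAlgebra.ι ℂ (Sum.inr g)

/-- The defining relations of the modular double. -/
inductive ModularRel (N : ℕ) (q q' : ℂ) : ModularFree N → ModularFree N → Prop
  | left {a b : ModularFree N}
      (h : UqglRel N q (fun n => freeL (.K n)) (fun n => freeL (.Kinv n))
        (fun n => freeL (.E n)) (fun n => freeL (.F n)) a b) : ModularRel N q q' a b
  | right {a b : ModularFree N}
      (h : UqglRel N q' (fun n => freeR (.K n)) (fun n => freeR (.Kinv n))
        (fun n => freeR (.E n)) (fun n => freeR (.F n)) a b) : ModularRel N q q' a b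
  | cross {a b : ModularFree N}
      (h : CrossRel N (fun n => freeL (.K n)) (fun n => freeL (.E n)) (fun n => freeL (.F n))
        (fun n => freeR (.K n)) (fun n => freeR (.E n)) (fun n => freeR (.F n)) a b) :
      ModularRel N q q' a b

/-- The modular double `M_{q q̃}(gl(N))`, as an associative unital `ℂ`-algebra. -/
abbrev ModularDouble (N : ℕ) (q q' : ℂ) : Type := RingQuot (ModularRel N q q')

namespace ModularDouble

/-- A generator without tilde. -/
def gen {N : ℕ} (q q' : ℂ) (g : UqglGen N) : ModularDouble N q q' :=
  RingQuot.mkAlgHom ℂ (ModularRel N q q') (freeL g)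

/-- A generator with tilde. -/
def genTilde {N : ℕ} (q q' : ℂ) (g : UqglGen N) : ModularDouble N q q' :=
  RingQuot.mkAlgHom ℂ (ModularRel N q q') (freeR g)

end ModularDouble

/-! ## The Gelfand–Zetlin operators -/

/-- The index set of the variables `γ_{n,j}`, `1 ≤ j ≤ n ≤ N - 1`: level `n` (as a number in
`{0, …, N-1}`) carries `n` variables, so that level `0` carries none. -/
abbrev GZIndex (N : ℕ) : Type := Σ n : Fin N, Fin n.val

/-- The space of meromorphic functions of the variables `γ_{n,j}`, `1 ≤ j ≤ n ≤ N - 1`. -/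
abbrev GZSpace (N : ℕ) : Type := MerFn (GZIndex N)

/-- `γ_{n,j}` for `0 ≤ n ≤ N`: a variable for `n < N`, the given parameter `c j` for `n = N`. -/
def gzGamma {N : ℕ} (c : Fin N → ℂ) (n : ℕ) (hn : n ≤ N) (j : Fin n) : EntireFn (GZIndex N) :=
  if h : n < N then EntireFn.coord ⟨⟨n, h⟩, j⟩ else EntireFn.const (c (Fin.castLE hn j))

/-- `exp (a ∂/∂γ_{n,j})`, that is, the shift `γ_{n,j} ↦ γ_{n,j} + a`, for `n < N`. -/
def gzShift {N : ℕ} (n : ℕ) (hn : n < N) (j : Fin n) (a : ℂ) : Module.End ℂ (GZSpace N) :=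
  MerFn.translate (Pi.single (⟨⟨n, hn⟩, j⟩ : GZIndex N) a)

/-- `q = exp (π i ω₁ / ω₂)`. -/
def qParam (ω₁ ω₂ : ℂ) : ℂ := Complex.exp (Real.pi * Complex.I * ω₁ / ω₂)

/-- `sinh ((π / ω) (f + a))` as a meromorphic function. -/
def gzSinh {N : ℕ} (ω : ℂ) (f : EntireFn (GZIndex N)) (a : ℂ) : GZSpace N :=
  MerFn.ofEntire (EntireFn.sinh (((Real.pi : ℂ) / ω) • (f + EntireFn.const a)))

/-- `∏_{s ≠ j} sinh ((π / ω) (γ_{n,j} - γ_{n,s}))`. -/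
def gzDenom {N : ℕ} (c : Fin N → ℂ) (ω : ℂ) (n : ℕ) (hn : n ≤ N) (j : Fin n) : GZSpace N :=
  ∏ s ∈ Finset.univ.erase j, gzSinh ω (gzGamma c n hn j - gzGamma c n hn s) 0

/-- The operator `E_{n+1,n+2}`. The shift in the first index makes the exponent `n` of the
prefactor here the `n - 1` of the usual indexing. -/
def gzE {N : ℕ} (c : Fin N → ℂ) (ω₁ ω₂ : ℂ) (n : Fin (N - 1)) : Module.End ℂ (GZSpace N) :=
  (2 * Complex.exp (Real.pi * Complex.I * (ω₁ + ω₂) * (n.val : ℂ) / (2 * ω₂)) /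
      (qParam ω₁ ω₂ - (qParam ω₁ ω₂)⁻¹)) •
    ∑ j : Fin (n.val + 1),
      MerFn.mulOp
        ((∏ r : Fin (n.val + 2),
            gzSinh ω₂ (gzGamma c (n.val + 1) (by omega) j - gzGamma c (n.val + 2) (by omega) r)
              (-(Complex.I / 2 * (ω₁ + ω₂)))) /
          gzDenom c ω₂ (n.val + 1) (by omega) j) *
      gzShift (n.val + 1) (by omega) j (-(Complex.I * ω₁))

/-- The operator `E_{n+2,n+1}`. -/
def gzF {N : ℕ} (c : Fin N → ℂ) (ω₁ ω₂ : ℂ) (n : Fin (N - 1)) : Module.End ℂ (GZSpace N) :=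
  (2 * Complex.exp (-(Real.pi * Complex.I * (ω₁ + ω₂) * (n.val : ℂ) / (2 * ω₂))) /
      (qParam ω₁ ω₂ - (qParam ω₁ ω₂)⁻¹)) •
    ∑ j : Fin (n.val + 1),
      MerFn.mulOp
        ((∏ r : Fin n.val,
            gzSinh ω₂ (gzGamma c (n.val + 1) (by omega) j - gzGamma c n.val (by omega) r)
              (Complex.I / 2 * (ω₁ + ω₂))) /
          gzDenom c ω₂ (n.val + 1) (by omega) j) *
      gzShift (n.val + 1) (by omega) j (Complex.I * ω₁)

/-- The operator `K_{n+1}`: multiplication by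
`exp ((π / ω) (∑_j γ_{n+1,j} - ∑_j γ_{n,j}))`. -/
def gzK {N : ℕ} (c : Fin N → ℂ) (ω : ℂ) (n : Fin N) : Module.End ℂ (GZSpace N) :=
  MerFn.mulOp (MerFn.ofEntire (EntireFn.exp (((Real.pi : ℂ) / ω) •
    (∑ j : Fin (n.val + 1), gzGamma c (n.val + 1) (by omega) j -
      ∑ j : Fin n.val, gzGamma c n.val (by omega) j))))

end

/-! In the variables `X n j`, the exponentials of πγ_{nj}/ω₂, all coefficients of the untilded
operators become rational functions, and the shifts that occur become field automorphisms
multiplying one variable by a constant. Up to scalars, each of E and F is a sum over j of difference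
operators moving one variable of a single level, while K multiplies by a Laurent monomial. Since all
shifts commute, a relation holds as soon as the coefficients belonging to the same total shift
agree: `diffSum_comm`, `diffSum_commutator`, `diffSum_serre`. Coefficients are quotients of products
of hyperbolic sines, and shifting any variable other than the coefficient's own changes at most one
factor, so most comparisons concern only a few factors.

Three points need more. (a) In the commutator of E and F of the same index the off-diagonal terms
cancel. The diagonal ones are, up to a common constant, the residues of P(z) / (z ∏ (z - p)) at the
nodes p = q^{±1} X_j², with P monic of degree the number of nodes. Their sum is the value of P / ∏
(z - p) at infinity minus its value at 0, and these two values are the two Cartan terms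
(`sum_prod_hsinh_sub`). (b) In the cubic Serre relation the total shift is symmetric in the two
indices i, j of the repeated operator, so only the symmetrized coefficient has to vanish. For i ≠ j
this is `hsinh_serre`; for i = j it is the addition formula `hsinh_mul_add_hsinh_div`. (c) The shift
by iω multiplies the exponential of πγ/ω by -1. Hence the cross-relations only require counting the
factors that change sign.

No denominator vanishes: a variable of level below N can be shifted independently of all other
quantities, so its square is never a constant multiple of the square of another one
(`genericAt_gzX`). This is why the parameters of level N may be arbitrary. -/

/-! ## Difference operators on meromorphic functions -/

namespace MerFn

variable {ι : Type} [Fintype ι]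

/-- Translation of meromorphic functions as an algebra automorphism. -/
noncomputable def shift (v : ι → ℂ) : MerFn ι ≃ₐ[ℂ] MerFn ι :=
  IsFractionRing.algEquivOfAlgEquiv (K := MerFn ι) (L := MerFn ι) (EntireFn.translate v)

theorem mulOp_apply (a b : MerFn ι) : mulOp a b = a * b := rfl

theorem shift_ofEntire (v : ι → ℂ) (f : EntireFn ι) :
    shift v (ofEntire f) = ofEntire (EntireFn.translate v f) :=
  IsFractionRing.algEquivOfAlgEquiv_algebraMap _ f

theorem shift_add (v w : ι → ℂ) (a : MerFn ι) : shift (v + w) a = shift v (shift w a) := by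
  -- Both sides are field automorphisms, so it suffices to compare them on numerators and
  -- denominators.
  obtain ⟨f, g, -, rfl⟩ := IsFractionRing.div_surjective (A := EntireFn ι) a
  have h : ∀ f : EntireFn ι, shift (v + w) (algebraMap _ _ f) =
      shift v (shift w (algebraMap _ _ f)) := fun f => by
    change shift (v + w) (ofEntire f) = shift v (shift w (ofEntire f))
    simp only [shift_ofEntire]
    congr 1
    refine Subtype.ext (funext fun x => ?_)
    exact congrArg f.1 (add_assoc x v w).symm
  simp only [map_div₀, h]

theorem shift_comm (v w : ι → ℂ) (a : MerFn ι) : shift v (shift w a) = shift w (shift v a) := by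
  rw [← shift_add, ← shift_add, add_comm]

/-- The difference operator `f ↦ a · f(· + v)`. -/
noncomputable def diffOp (a : MerFn ι) (v : ι → ℂ) : Module.End ℂ (MerFn ι) :=
  mulOp a * translate v

theorem diffOp_apply (a : MerFn ι) (v : ι → ℂ) (b : MerFn ι) :
    diffOp a v b = a * shift v b := rfl

theorem diffOp_mul (a b : MerFn ι) (v w : ι → ℂ) :
    diffOp a v * diffOp b w = diffOp (a * shift v b) (v + w) := by
  ext f
  simp [diffOp_apply, Module.End.mul_apply, shift_add, mul_assoc]

theorem smul_diffOp (z : ℂ) (a : MerFn ι) (v : ι → ℂ) :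
    z • diffOp a v = diffOp (z • a) v := by
  ext f
  simp [diffOp_apply]

theorem diffOp_add (a b : MerFn ι) (v : ι → ℂ) :
    diffOp (a + b) v = diffOp a v + diffOp b v := by
  ext f
  simp [diffOp_apply, add_mul]

theorem diffOp_sub (a b : MerFn ι) (v : ι → ℂ) :
    diffOp (a - b) v = diffOp a v - diffOp b v := by
  ext f
  simp [diffOp_apply, sub_mul]

theorem diffOp_zero_left (v : ι → ℂ) : diffOp (0 : MerFn ι) v = 0 := by
  ext f
  simp [diffOp_apply]

theorem diffOp_zero_right (a : MerFn ι) : diffOp a 0 = mulOp a := by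
  ext f
  have h : shift (0 : ι → ℂ) f = f := by
    apply (shift (0 : ι → ℂ)).injective
    rw [← shift_add, add_zero]
  simp [diffOp_apply, mulOp_apply, h]

theorem mulOp_mul (a b : MerFn ι) : mulOp a * mulOp b = mulOp (a * b) := by
  ext f
  simp [mulOp_apply, mul_assoc]

theorem mulOp_sum {κ : Type*} (s : Finset κ) (a : κ → MerFn ι) :
    mulOp (∑ i ∈ s, a i) = ∑ i ∈ s, mulOp (a i) := by
  ext f
  simp [mulOp_apply, Finset.sum_mul]

/-- A sum of difference operators. -/
noncomputable def diffSum {κ : Type} [Fintype κ] (a : κ → MerFn ι) (v : κ → ι → ℂ) :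
    Module.End ℂ (MerFn ι) :=
  ∑ i, diffOp (a i) (v i)

variable {κ κ' : Type} [Fintype κ] [Fintype κ']

theorem diffSum_mul_diffSum (a : κ → MerFn ι) (v : κ → ι → ℂ) (b : κ' → MerFn ι)
    (w : κ' → ι → ℂ) :
    diffSum a v * diffSum b w = ∑ i, ∑ k, diffOp (a i * shift (v i) (b k)) (v i + w k) := by
  simp only [diffSum, Finset.sum_mul_sum, diffOp_mul]

/-- Shifts commute, so the terms (i, k) of the two products carry the same shift and only their
coefficients have to be compared. -/
theorem diffSum_comm (a : κ → MerFn ι) (v : κ → ι → ℂ) (b : κ' → MerFn ι) (w : κ' → ι → ℂ)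
    (z : ℂ) (h : ∀ i k, a i * shift (v i) (b k) = z • (b k * shift (w k) (a i))) :
    diffSum a v * diffSum b w = z • (diffSum b w * diffSum a v) := by
  rw [diffSum_mul_diffSum, diffSum_mul_diffSum, Finset.sum_comm]
  simp only [Finset.smul_sum, smul_diffOp, h, add_comm]

theorem diffSum_mul_mulOp (a : κ → MerFn ι) (v : κ → ι → ℂ) (b : MerFn ι) (z : ℂ)
    (h : ∀ i, shift (v i) b = z • b) :
    diffSum a v * mulOp b = z • (mulOp b * diffSum a v) := by
  simp only [diffSum, Finset.sum_mul, Finset.mul_sum, Finset.smul_sum]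
  refine Finset.sum_congr rfl fun i _ => ?_
  ext f
  simp [diffOp_apply, mulOp_apply, h, mul_left_comm]

/-- If the coefficients at `v i + w k` with `i ≠ k` cancel, the commutator of two sums of
difference operators with opposite shifts is a multiplication operator. -/
theorem diffSum_commutator (a b : κ → MerFn ι) (v w : κ → ι → ℂ) (hvw : ∀ i, v i + w i = 0)
    (h : ∀ i k, i ≠ k → a i * shift (v i) (b k) = b k * shift (w k) (a i)) :
    diffSum a v * diffSum b w - diffSum b w * diffSum a v =
      mulOp (∑ i, (a i * shift (v i) (b i) - b i * shift (w i) (a i))) := by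
  classical
  rw [diffSum_mul_diffSum, diffSum_mul_diffSum,
    Finset.sum_comm (f := fun i k => diffOp (b i * shift (w i) (a k)) (w i + v k)),
    ← Finset.sum_sub_distrib, mulOp_sum]
  refine Finset.sum_congr rfl fun i _ => ?_
  rw [← Finset.sum_sub_distrib, Finset.sum_eq_single i]
  · rw [add_comm (w i), hvw, ← diffOp_sub, diffOp_zero_right]
  · intro k _ hk
    rw [h i k hk.symm, add_comm (w k), sub_self]
  · simp

theorem diffSum_mul_diffSum_mul_diffSum {κ'' : Type} [Fintype κ''] (a : κ → MerFn ι)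
    (v : κ → ι → ℂ) (b : κ' → MerFn ι) (w : κ' → ι → ℂ) (c : κ'' → MerFn ι) (u : κ'' → ι → ℂ) :
    diffSum a v * diffSum b w * diffSum c u =
      ∑ i, ∑ j, ∑ k, diffOp (a i * shift (v i) (b j) * shift (v i) (shift (w j) (c k)))
        (v i + w j + u k) := by
  rw [diffSum_mul_diffSum, diffSum, Finset.sum_mul]
  refine Finset.sum_congr rfl fun i _ => ?_
  rw [Finset.sum_mul]
  refine Finset.sum_congr rfl fun j _ => ?_
  rw [Finset.mul_sum]
  refine Finset.sum_congr rfl fun k _ => ?_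
  rw [diffOp_mul, shift_add]

/-- The coefficients of the left-hand side of the cubic Serre relation for sums of difference
operators, before symmetrization. -/
noncomputable def serreCoeff (a : κ → MerFn ι) (v : κ → ι → ℂ) (b : κ' → MerFn ι)
    (w : κ' → ι → ℂ) (z : ℂ) (i j : κ) (k : κ') : MerFn ι :=
  a i * shift (v i) (a j) * shift (v i) (shift (v j) (b k)) -
    z • (a i * shift (v i) (b k) * shift (v i) (shift (w k) (a j))) +
    b k * shift (w k) (a i) * shift (v i) (shift (w k) (a j))

/-- The three products contain the same shifts in different orders. Renaming the summation indices
gives them all the shift `v i + v j + w k`, after which the coefficients can be collected. -/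
theorem diffSum_serre_eq (a : κ → MerFn ι) (v : κ → ι → ℂ) (b : κ' → MerFn ι) (w : κ' → ι → ℂ)
    (z : ℂ) :
    diffSum a v ^ 2 * diffSum b w - z • (diffSum a v * diffSum b w * diffSum a v) +
      diffSum b w * diffSum a v ^ 2 =
      ∑ i, ∑ j, ∑ k, diffOp (serreCoeff a v b w z i j k) (v i + v j + w k) := by
  have h2 : diffSum a v * diffSum b w * diffSum a v = ∑ i, ∑ j, ∑ k,
      diffOp (a i * shift (v i) (b k) * shift (v i) (shift (w k) (a j)))
        (v i + v j + w k) := by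
    rw [diffSum_mul_diffSum_mul_diffSum]
    refine Finset.sum_congr rfl fun i _ => Finset.sum_comm.trans ?_
    refine Finset.sum_congr rfl fun j _ => Finset.sum_congr rfl fun k _ => ?_
    rw [add_right_comm]
  have h3 : diffSum b w * diffSum a v * diffSum a v = ∑ i, ∑ j, ∑ k,
      diffOp (b k * shift (w k) (a i) * shift (v i) (shift (w k) (a j)))
        (v i + v j + w k) := by
    rw [diffSum_mul_diffSum_mul_diffSum]
    refine Finset.sum_comm.trans (Finset.sum_congr rfl fun i _ => Finset.sum_comm.trans ?_)
    refine Finset.sum_congr rfl fun j _ => Finset.sum_congr rfl fun k _ => ?_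
    rw [add_comm (w k) (v i), add_right_comm, shift_comm (w k)]
  rw [pow_two, ← mul_assoc, h2, h3, diffSum_mul_diffSum_mul_diffSum, Finset.smul_sum,
    ← Finset.sum_sub_distrib, ← Finset.sum_add_distrib]
  refine Finset.sum_congr rfl fun i _ => ?_
  rw [Finset.smul_sum, ← Finset.sum_sub_distrib, ← Finset.sum_add_distrib]
  refine Finset.sum_congr rfl fun j _ => ?_
  rw [Finset.smul_sum, ← Finset.sum_sub_distrib, ← Finset.sum_add_distrib]
  refine Finset.sum_congr rfl fun k _ => ?_
  rw [serreCoeff, diffOp_add, diffOp_sub, smul_diffOp]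

/-- The shift `v i + v j + w k` does not see the order of `i` and `j`. Adding the sum to its copy
with `i`, `j` exchanged gives twice the sum, and this vanishes term by term. -/
theorem diffSum_serre (a : κ → MerFn ι) (v : κ → ι → ℂ) (b : κ' → MerFn ι) (w : κ' → ι → ℂ)
    (z : ℂ) (h : ∀ i j k, serreCoeff a v b w z i j k + serreCoeff a v b w z j i k = 0) :
    diffSum a v ^ 2 * diffSum b w - z • (diffSum a v * diffSum b w * diffSum a v) +
      diffSum b w * diffSum a v ^ 2 = 0 := by
  rw [diffSum_serre_eq]
  have swap : ∑ i, ∑ j, ∑ k, diffOp (serreCoeff a v b w z i j k) (v i + v j + w k) =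
      ∑ i, ∑ j, ∑ k, diffOp (serreCoeff a v b w z j i k) (v i + v j + w k) := by
    refine Finset.sum_comm.trans ?_
    refine Finset.sum_congr rfl fun i _ => Finset.sum_congr rfl fun j _ => ?_
    rw [add_comm (v j)]
  have hS : ∑ i, ∑ j, ∑ k, diffOp (serreCoeff a v b w z i j k) (v i + v j + w k) +
      ∑ i, ∑ j, ∑ k, diffOp (serreCoeff a v b w z i j k) (v i + v j + w k) = 0 := by
    nth_rewrite 2 [swap]
    rw [← Finset.sum_add_distrib]
    refine Finset.sum_eq_zero fun i _ => ?_
    rw [← Finset.sum_add_distrib]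
    refine Finset.sum_eq_zero fun j _ => ?_
    rw [← Finset.sum_add_distrib]
    refine Finset.sum_eq_zero fun k _ => ?_
    rw [← diffOp_add, h, diffOp_zero_left]
  rw [← two_smul ℂ] at hS
  exact (smul_eq_zero.mp hS).resolve_left two_ne_zero

end MerFn

/-! ## Algebra of the hyperbolic sine in exponential variables -/

section HSinh

variable {L : Type*} [Field L]

/-- The hyperbolic sine in terms of the exponential `x` of its argument. -/
def hsinh (x : L) : L := (x - x⁻¹) / 2

theorem hsinh_inv (x : L) : hsinh x⁻¹ = -hsinh x := by
  simp only [hsinh, inv_inv]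
  ring

theorem hsinh_neg (x : L) : hsinh (-x) = -hsinh x := by
  simp only [hsinh, inv_neg]
  ring

theorem map_hsinh {L' : Type*} [Field L'] {F : Type*} [FunLike F L L'] [RingHomClass F L L']
    (σ : F) (x : L) : σ (hsinh x) = hsinh (σ x) := by
  simp only [hsinh, map_div₀, map_sub, map_inv₀, map_ofNat]

variable [CharZero L]

theorem hsinh_ne_zero {x : L} (hx : x ≠ 0) (h : x ^ 2 ≠ 1) : hsinh x ≠ 0 := by
  intro h0
  apply h
  simp only [hsinh] at h0
  field_simp at h0
  linear_combination h0

/-- This is sinh(a + b) + sinh(a - b) = 2 cosh b sinh a. It settles the diagonal terms of the Serre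
relation. -/
theorem hsinh_mul_add_hsinh_div {x t : L} (ht : t ≠ 0) (hx : x ≠ 0) :
    hsinh (t * x) + hsinh (x * t⁻¹) = (t + t⁻¹) * hsinh x := by
  simp only [hsinh]
  field_simp
  ring

/-- The cubic Serre identity for two distinct points, in polynomial form. -/
theorem hsinh_serre {x y t : L} (hx : x ≠ 0) (hy : y ≠ 0) (ht : t ≠ 0) :
    (hsinh x * hsinh y - (t + t⁻¹) * (hsinh x * hsinh (y * t⁻¹)) +
        hsinh (x * t⁻¹) * hsinh (y * t⁻¹)) * hsinh (x * y⁻¹ * t⁻¹) =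
      (hsinh x * hsinh y - (t + t⁻¹) * (hsinh y * hsinh (x * t⁻¹)) +
        hsinh (x * t⁻¹) * hsinh (y * t⁻¹)) * hsinh (y * x⁻¹ * t⁻¹) := by
  simp only [hsinh]
  field_simp
  ring

end HSinh

/-! ### Symmetrized Serre coefficients of two distinct points. -/

section Serre

variable {L : Type*} [Field L] [CharZero L]

/-- Symmetrized Serre coefficient of a pair, when the shift of the second operator acts on the
coefficients of the first one. -/
theorem serre_pair_eq_zero {x y t : L} (hx : x ≠ 0) (hy : y ≠ 0) (ht : t ≠ 0)
    (h1 : hsinh x ≠ 0) (h2 : hsinh y ≠ 0) (h3 : hsinh (x * y⁻¹ * t⁻¹) ≠ 0)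
    (h4 : hsinh (y * x⁻¹ * t⁻¹) ≠ 0) :
    hsinh (y * x⁻¹) / hsinh (y * x⁻¹ * t⁻¹) *
        (1 - (t + t⁻¹) * (hsinh (y * t⁻¹) / hsinh y) +
          hsinh (x * t⁻¹) / hsinh x * (hsinh (y * t⁻¹) / hsinh y)) +
      hsinh (x * y⁻¹) / hsinh (x * y⁻¹ * t⁻¹) *
        (1 - (t + t⁻¹) * (hsinh (x * t⁻¹) / hsinh x) +
          hsinh (x * t⁻¹) / hsinh x * (hsinh (y * t⁻¹) / hsinh y)) = 0 := by
  have h := hsinh_serre hx hy ht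
  -- By oddness the two outer numerators differ by a sign; once denominators are cleared, the claim
  -- is their common value times `hsinh_serre`.
  have h5 : hsinh (x * y⁻¹) = -hsinh (y * x⁻¹) := by
    rw [← hsinh_inv, mul_inv, inv_inv, mul_comm]
  rw [h5]
  generalize hsinh (x * y⁻¹ * t⁻¹) = A at *
  generalize hsinh (y * x⁻¹ * t⁻¹) = B at *
  generalize hsinh (y * x⁻¹) = C at *
  generalize hsinh x = X at *
  generalize hsinh y = Y at *
  generalize hsinh (x * t⁻¹) = X' at *
  generalize hsinh (y * t⁻¹) = Y' at *
  generalize t + t⁻¹ = T at *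
  field_simp
  linear_combination C * h

/-- Symmetrized Serre coefficient of a pair, when the shift of the first operator acts on the
coefficients of the second one. -/
theorem serre_pair_eq_zero' {x y t : L} (hx : x ≠ 0) (hy : y ≠ 0) (ht : t ≠ 0)
    (h1 : hsinh x ≠ 0) (h2 : hsinh y ≠ 0) (h3 : hsinh (y * x⁻¹ * t⁻¹) ≠ 0)
    (h4 : hsinh (x * y⁻¹ * t⁻¹) ≠ 0) :
    hsinh (x * y⁻¹) / hsinh (x * y⁻¹ * t⁻¹) *
        (hsinh (x * t⁻¹) / hsinh x * (hsinh (y * t⁻¹) / hsinh y) -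
          (t + t⁻¹) * (hsinh (x * t⁻¹) / hsinh x) + 1) +
      hsinh (y * x⁻¹) / hsinh (y * x⁻¹ * t⁻¹) *
        (hsinh (x * t⁻¹) / hsinh x * (hsinh (y * t⁻¹) / hsinh y) -
          (t + t⁻¹) * (hsinh (y * t⁻¹) / hsinh y) + 1) = 0 := by
  linear_combination serre_pair_eq_zero hx hy ht h1 h2 h4 h3

end Serre

/-! ## Partial fractions -/

section PartialFractions

/-- A product over a whole type can be split along `Option` or a sum type, which a product over an
erased set cannot be directly. -/
theorem Finset.prod_univ_erase {κ M : Type*} [Fintype κ] [DecidableEq κ] [CommMonoid M] (j : κ)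
    (f : κ → M) :
    ∏ s ∈ Finset.univ.erase j, f s = ∏ s, if s = j then 1 else f s := by
  rw [← Finset.mul_prod_erase Finset.univ _ (Finset.mem_univ j), if_pos rfl, one_mul]
  exact Finset.prod_congr rfl fun s hs => (if_neg (Finset.ne_of_mem_erase hs)).symm

open Polynomial

variable {L : Type*} [Field L]

/-- Comparison of the values at `∞` and `0` of a quotient of two monic polynomials of the same
degree. -/
theorem sum_eval_div_mul_prod_sub {κ : Type*} [Fintype κ] [DecidableEq κ] (p : κ → L)
    (hp : Function.Injective p) (hp0 : ∀ i, p i ≠ 0) (P : L[X]) (hP : P.Monic)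
    (hdeg : P.natDegree = Fintype.card κ) :
    ∑ i, P.eval (p i) / (p i * ∏ k ∈ Finset.univ.erase i, (p i - p k)) =
      1 - P.eval 0 / ∏ k, (-p k) := by
  classical
  -- Zero is added as an extra node, which produces the factor `p i` in the denominators and the
  -- term `P.eval 0`.
  let v : Option κ → L := fun o => o.elim 0 p
  have hv : Function.Injective v := by
    rintro (_ | a) (_ | b) hab
    · rfl
    · exact absurd hab.symm (hp0 b)
    · exact absurd hab (hp0 a)
    · exact congrArg some (hp hab)
  -- Lagrange interpolation at one node more than the degree of `P` recovers its leading
  -- coefficient, which is 1.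
  have h := Lagrange.coeff_eq_sum (s := Finset.univ) (v := v) hv.injOn (P := P) (by
    rw [Polynomial.degree_eq_natDegree hP.ne_zero, hdeg, Finset.card_univ, Fintype.card_option]
    exact_mod_cast Nat.lt_succ_self _)
  rw [Finset.card_univ, Fintype.card_option, Nat.add_sub_cancel, ← hdeg, hP.coeff_natDegree,
    Fintype.sum_option] at h
  have e0 : ∏ j ∈ Finset.univ.erase (none : Option κ), (v none - v j) = ∏ k, (-p k) := by
    rw [Finset.prod_univ_erase, Fintype.prod_option]
    simp [v]
  have e1 : ∀ i, ∏ j ∈ Finset.univ.erase (some i), (v (some i) - v j) =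
      p i * ∏ k ∈ Finset.univ.erase i, (p i - p k) := by
    intro i
    rw [Finset.prod_univ_erase, Fintype.prod_option, Finset.prod_univ_erase]
    simp [v]
  rw [e0] at h
  simp only [e1] at h
  have h' : v none = 0 := rfl
  rw [h'] at h
  have h'' : ∀ i, v (some i) = p i := fun _ => rfl
  simp only [h''] at h
  rw [h]
  ring

/-- One term of the partial fraction expansion, in hyperbolic form. -/
theorem prod_hsinh_div_prod_hsinh [CharZero L] {J R R' : Type*} (T : Finset J) [Fintype R]
    [Fintype R'] (m : ℕ) (hT : T.card = m) (hR : Fintype.card R = m + 2)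
    (hR' : Fintype.card R' = m) {q u x : L} (hq : q ≠ 0) (hq1 : q ^ 2 ≠ 1) (hu : u ^ 2 = -q)
    (hx : x ≠ 0) (X : J → L) (hX : ∀ s, X s ≠ 0) (Y : R → L) (hY : ∀ r, Y r ≠ 0) (Z : R' → L)
    (hZ : ∀ r, Z r ≠ 0) (hxX : ∀ s ∈ T, x ^ 2 ≠ X s ^ 2)
    (hxX' : ∀ s ∈ T, q⁻¹ * x ^ 2 - q * X s ^ 2 ≠ 0) :
    (∏ r, hsinh (x * (Y r)⁻¹ * u⁻¹)) / (∏ s ∈ T, hsinh (x * (X s)⁻¹)) *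
      ((∏ r, hsinh (q⁻¹ * x * (Z r)⁻¹ * u)) / ∏ s ∈ T, hsinh (q⁻¹ * x * (X s)⁻¹)) =
    (q - q⁻¹) / 4 * ((x * ∏ s ∈ T, X s) ^ 2 / ((∏ r, Y r) * ∏ r, Z r)) *
      (((∏ r, (q⁻¹ * x ^ 2 + Y r ^ 2)) * ∏ r, (q⁻¹ * x ^ 2 + Z r ^ 2)) /
        (q⁻¹ * x ^ 2 * ((∏ s ∈ T, (q⁻¹ * x ^ 2 - q⁻¹ * X s ^ 2)) *
          ((q⁻¹ * x ^ 2 - q * x ^ 2) * ∏ s ∈ T, (q⁻¹ * x ^ 2 - q * X s ^ 2))))) := by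
  have hu0 : u ≠ 0 := by
    rintro rfl
    exact hq (by simpa using hu.symm)
  have hq2 : 1 - q ^ 2 ≠ 0 := sub_ne_zero.mpr hq1.symm
  have hcard : (Finset.univ : Finset R).card = m + 2 := hR
  have hcard' : (Finset.univ : Finset R').card = m := hR'
  -- In all four products each factor is written through squares of the variables; `u ^ 2 = -q`
  -- makes them linear factors at the node `q⁻¹ * x ^ 2`.
  have e1 : ∏ r, hsinh (x * (Y r)⁻¹ * u⁻¹) =
      (-u / (2 * x)) ^ (m + 2) * (∏ r, (q⁻¹ * x ^ 2 + Y r ^ 2)) * (∏ r, Y r)⁻¹ := by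
    rw [← hcard, ← Finset.prod_inv_distrib, ← Finset.prod_const, ← Finset.prod_mul_distrib,
      ← Finset.prod_mul_distrib]
    refine Finset.prod_congr rfl fun r _ => ?_
    have := hY r
    simp only [hsinh]
    field_simp
    linear_combination x ^ 2 * hu
  have e2 : ∏ r, hsinh (q⁻¹ * x * (Z r)⁻¹ * u) =
      (-q / (2 * u * x)) ^ m * (∏ r, (q⁻¹ * x ^ 2 + Z r ^ 2)) * (∏ r, Z r)⁻¹ := by
    rw [← hcard', ← Finset.prod_inv_distrib, ← Finset.prod_const, ← Finset.prod_mul_distrib,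
      ← Finset.prod_mul_distrib]
    refine Finset.prod_congr rfl fun r _ => ?_
    have := hZ r
    simp only [hsinh]
    field_simp
    linear_combination x ^ 2 * hu
  have e3 : ∏ s ∈ T, hsinh (x * (X s)⁻¹) =
      (q / (2 * x)) ^ m * (∏ s ∈ T, (q⁻¹ * x ^ 2 - q⁻¹ * X s ^ 2)) * (∏ s ∈ T, X s)⁻¹ := by
    rw [← hT, ← Finset.prod_inv_distrib, ← Finset.prod_const, ← Finset.prod_mul_distrib,
      ← Finset.prod_mul_distrib]
    refine Finset.prod_congr rfl fun s _ => ?_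
    have := hX s
    simp only [hsinh]
    field_simp
  have e4 : ∏ s ∈ T, hsinh (q⁻¹ * x * (X s)⁻¹) =
      (1 / (2 * x)) ^ m * (∏ s ∈ T, (q⁻¹ * x ^ 2 - q * X s ^ 2)) * (∏ s ∈ T, X s)⁻¹ := by
    rw [← hT, ← Finset.prod_inv_distrib, ← Finset.prod_const, ← Finset.prod_mul_distrib,
      ← Finset.prod_mul_distrib]
    refine Finset.prod_congr rfl fun s _ => ?_
    have := hX s
    simp only [hsinh]
    field_simp
  have d1 : ∏ s ∈ T, (q⁻¹ * x ^ 2 - q⁻¹ * X s ^ 2) ≠ 0 := Finset.prod_ne_zero_iff.mpr fun s hs => by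
    rw [← mul_sub]
    exact mul_ne_zero (inv_ne_zero hq) (sub_ne_zero.mpr (hxX s hs))
  have d2 : ∏ s ∈ T, (q⁻¹ * x ^ 2 - q * X s ^ 2) ≠ 0 := Finset.prod_ne_zero_iff.mpr hxX'
  have d3 : ∏ s ∈ T, X s ≠ 0 := Finset.prod_ne_zero_iff.mpr fun s _ => hX s
  have d4 : ∏ r, Y r ≠ 0 := Finset.prod_ne_zero_iff.mpr fun s _ => hY s
  have d5 : ∏ r, Z r ≠ 0 := Finset.prod_ne_zero_iff.mpr fun s _ => hZ s
  rw [e1, e2, e3, e4]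
  generalize ∏ s ∈ T, (q⁻¹ * x ^ 2 - q⁻¹ * X s ^ 2) = D1 at *
  generalize ∏ s ∈ T, (q⁻¹ * x ^ 2 - q * X s ^ 2) = D2 at *
  generalize ∏ s ∈ T, X s = D3 at *
  generalize ∏ r, Y r = D4 at *
  generalize ∏ r, Z r = D5 at *
  generalize ∏ r, (q⁻¹ * x ^ 2 + Y r ^ 2) = D6 at *
  generalize ∏ r, (q⁻¹ * x ^ 2 + Z r ^ 2) = D7 at *
  -- The numerators have two more factors than the denominators, so the powers with exponent `m`
  -- cancel and a constant times `x ^ (-2)` remains.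
  have hpow : (-u / (2 * x)) ^ (m + 2) * (-q / (2 * u * x)) ^ m =
      -q / (4 * x ^ 2) * ((q / (2 * x)) ^ m * (1 / (2 * x)) ^ m) := by
    rw [pow_add, mul_right_comm, ← mul_pow, ← mul_pow, mul_comm]
    congr 1
    · field_simp
      linear_combination 4 * hu
    · congr 1
      field_simp
  have hqx : q⁻¹ * x ^ 2 - q * x ^ 2 = (1 - q ^ 2) * x ^ 2 / q := by
    field_simp
  have hqq : q - q⁻¹ = -(1 - q ^ 2) / q := by
    field_simp
    ring
  rw [hqx, hqq]
  generalize 1 - q ^ 2 = Q at *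
  have c1 : (q / (2 * x)) ^ m ≠ 0 := pow_ne_zero _ (by simp [hq, hx])
  have c2 : (1 / (2 * x)) ^ m ≠ 0 := pow_ne_zero _ (by simp [hx])
  calc _ = ((-u / (2 * x)) ^ (m + 2) * (-q / (2 * u * x)) ^ m) * D6 * D7 * D4⁻¹ * D5⁻¹ /
        (((q / (2 * x)) ^ m * (1 / (2 * x)) ^ m) * D1 * D2 * D3⁻¹ * D3⁻¹) := by
          rw [div_mul_div_comm]
          congr 1 <;> ring
    _ = _ := by
      rw [hpow]
      generalize (q / (2 * x)) ^ m = P1 at *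
      generalize (1 / (2 * x)) ^ m = P2 at *
      field_simp

/-- The partial fraction identity behind `[E_n, F_n]`. -/
theorem sum_prod_hsinh_sub [CharZero L] {J R R' : Type*} [Fintype J] [DecidableEq J] [Fintype R]
    [Fintype R'] (m : ℕ) (hJ : Fintype.card J = m + 1) (hR : Fintype.card R = m + 2)
    (hR' : Fintype.card R' = m) {q u : L} (hq : q ≠ 0) (hq1 : q ^ 2 ≠ 1) (hu : u ^ 2 = -q)
    (X : J → L) (hX : ∀ s, X s ≠ 0) (Y : R → L) (hY : ∀ r, Y r ≠ 0) (Z : R' → L)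
    (hZ : ∀ r, Z r ≠ 0) (hXX : ∀ j s, j ≠ s → X j ^ 2 ≠ X s ^ 2)
    (hXX' : ∀ j s, j ≠ s → q ^ 2 * X j ^ 2 ≠ X s ^ 2) :
    ∑ j, ((∏ r, hsinh (X j * (Y r)⁻¹ * u⁻¹)) /
          (∏ s ∈ Finset.univ.erase j, hsinh (X j * (X s)⁻¹)) *
        ((∏ r, hsinh (q⁻¹ * X j * (Z r)⁻¹ * u)) /
          ∏ s ∈ Finset.univ.erase j, hsinh (q⁻¹ * X j * (X s)⁻¹)) -
      (∏ r, hsinh (X j * (Z r)⁻¹ * u)) /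
          (∏ s ∈ Finset.univ.erase j, hsinh (X j * (X s)⁻¹)) *
        ((∏ r, hsinh (q * X j * (Y r)⁻¹ * u⁻¹)) /
          ∏ s ∈ Finset.univ.erase j, hsinh (q * X j * (X s)⁻¹))) =
    (q - q⁻¹) / 4 * ((∏ j, X j) ^ 2 / ((∏ r, Y r) * ∏ r, Z r) -
      ((∏ r, Y r) * ∏ r, Z r) / (∏ j, X j) ^ 2) := by
  classical
  have hu0 : u ≠ 0 := by
    rintro rfl
    exact hq (by simpa using hu.symm)
  -- The products of E and F in the two orders supply the residues at the nodes `q⁻¹ * X j ^ 2` and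
  -- `q * X j ^ 2` respectively. There are 2(m + 1) nodes, which is the degree (m + 2) + m of `P`
  -- below.
  let p : J ⊕ J → L := Sum.elim (fun j => q⁻¹ * X j ^ 2) (fun j => q * X j ^ 2)
  have hp0 : ∀ i, p i ≠ 0 := by
    rintro (j | j)
    · exact mul_ne_zero (inv_ne_zero hq) (pow_ne_zero 2 (hX j))
    · exact mul_ne_zero hq (pow_ne_zero 2 (hX j))
  have hne : ∀ j s, q⁻¹ * X j ^ 2 ≠ q * X s ^ 2 := by
    intro j s h
    have h' : q ^ 2 * X s ^ 2 = X j ^ 2 := by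
      field_simp at h
      linear_combination -h
    by_cases hjs : s = j
    · subst hjs
      exact hq1 (mul_right_cancel₀ (pow_ne_zero 2 (hX s)) (h'.trans (one_mul _).symm))
    · exact hXX' s j hjs h'
  have hp : Function.Injective p := by
    rintro (j | j) (s | s) h
    · by_contra hc
      exact hXX j s (fun h => hc (congrArg _ h)) (mul_left_cancel₀ (inv_ne_zero hq) h)
    · exact absurd h (hne j s)
    · exact absurd h.symm (hne s j)
    · by_contra hc
      exact hXX j s (fun h => hc (congrArg _ h)) (mul_left_cancel₀ hq h)
  let P : L[X] := (∏ r, (Polynomial.X + C (Y r ^ 2))) * ∏ r, (Polynomial.X + C (Z r ^ 2))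
  have hPe : ∀ t, P.eval t = (∏ r, (t + Y r ^ 2)) * ∏ r, (t + Z r ^ 2) := fun t => by
    simp [P, eval_prod]
  have hM1 : (∏ r, (Polynomial.X + C (Y r ^ 2))).Monic :=
    monic_prod_of_monic _ _ fun r _ => monic_X_add_C _
  have hM2 : (∏ r, (Polynomial.X + C (Z r ^ 2))).Monic :=
    monic_prod_of_monic _ _ fun r _ => monic_X_add_C _
  have hdeg : P.natDegree = Fintype.card (J ⊕ J) := by
    rw [hM1.natDegree_mul hM2, natDegree_prod_of_monic _ _ fun r _ => monic_X_add_C _,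
      natDegree_prod_of_monic _ _ fun r _ => monic_X_add_C _]
    simp only [natDegree_X_add_C, Finset.sum_const, Finset.card_univ, smul_eq_mul, mul_one, hR,
      hR', Fintype.card_sum, hJ]
    ring
  have main := sum_eval_div_mul_prod_sub p hp hp0 P (hM1.mul hM2) hdeg
  have pe1 : ∀ j, ∏ k ∈ Finset.univ.erase (Sum.inl j : J ⊕ J), (p (Sum.inl j) - p k) =
      (∏ s ∈ Finset.univ.erase j, (q⁻¹ * X j ^ 2 - q⁻¹ * X s ^ 2)) *
        ((q⁻¹ * X j ^ 2 - q * X j ^ 2) *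
          ∏ s ∈ Finset.univ.erase j, (q⁻¹ * X j ^ 2 - q * X s ^ 2)) := fun j => by
    rw [Finset.mul_prod_erase Finset.univ (fun s => q⁻¹ * X j ^ 2 - q * X s ^ 2)
      (Finset.mem_univ j), Finset.prod_univ_erase, Finset.prod_univ_erase,
      Fintype.prod_sum_type]
    simp [p]
  have pe2 : ∀ j, ∏ k ∈ Finset.univ.erase (Sum.inr j : J ⊕ J), (p (Sum.inr j) - p k) =
      (∏ s ∈ Finset.univ.erase j, (q * X j ^ 2 - q * X s ^ 2)) *
        ((q * X j ^ 2 - q⁻¹ * X j ^ 2) *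
          ∏ s ∈ Finset.univ.erase j, (q * X j ^ 2 - q⁻¹ * X s ^ 2)) := fun j => by
    rw [Finset.mul_prod_erase Finset.univ (fun s => q * X j ^ 2 - q⁻¹ * X s ^ 2)
      (Finset.mem_univ j), Finset.prod_univ_erase, Finset.prod_univ_erase,
      Fintype.prod_sum_type, mul_comm]
    simp [p]
  rw [Fintype.sum_sum_type] at main
  simp only [pe1, pe2, hPe] at main
  have hcard : ∀ j : J, (Finset.univ.erase j).card = m := fun j => by
    rw [Finset.card_erase_of_mem (Finset.mem_univ j), Finset.card_univ, hJ, Nat.add_sub_cancel]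
  have t1 := fun j => prod_hsinh_div_prod_hsinh (Finset.univ.erase j) m (hcard j) hR hR' hq hq1 hu
    (hX j) X hX Y hY Z hZ (fun s hs => hXX j s (Finset.ne_of_mem_erase hs).symm)
    (fun s _ => sub_ne_zero.mpr (hne j s))
  -- The second family of nodes follows from the first by `q ↦ q⁻¹`, `u ↦ q⁻¹ * u`, since (q⁻¹u)² =
  -- -q⁻¹. The prefactor changes sign, which turns the difference in the claim into one sum over all
  -- nodes.
  have t2 := fun j => prod_hsinh_div_prod_hsinh (Finset.univ.erase j) m (hcard j) hR hR'
    (q := q⁻¹) (u := q⁻¹ * u) (inv_ne_zero hq)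
    (fun h => hq1 (by rw [inv_pow] at h; exact inv_eq_one.mp h))
    (by rw [mul_pow, hu]; field_simp)
    (hX j) X hX Y hY Z hZ (fun s hs => hXX j s (Finset.ne_of_mem_erase hs).symm)
    (fun s _ => by rw [inv_inv]; exact sub_ne_zero.mpr (hne s j).symm)
  simp only [inv_inv, mul_inv] at t2
  have a1 : ∀ j r, X j * (Y r)⁻¹ * (q * u⁻¹) = q * X j * (Y r)⁻¹ * u⁻¹ := fun j r => by ring
  have a2 : ∀ j r, q * X j * (Z r)⁻¹ * (q⁻¹ * u) = X j * (Z r)⁻¹ * u := fun j r => by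
    field_simp
  simp only [a1, a2] at t2
  have hprod : ∀ j, X j * ∏ s ∈ Finset.univ.erase j, X s = ∏ j, X j := fun j =>
    Finset.mul_prod_erase _ _ (Finset.mem_univ j)
  simp only [hprod] at t1 t2
  have hswap : ∀ j, (∏ r, hsinh (X j * (Z r)⁻¹ * u)) /
          (∏ s ∈ Finset.univ.erase j, hsinh (X j * (X s)⁻¹)) *
        ((∏ r, hsinh (q * X j * (Y r)⁻¹ * u⁻¹)) /
          ∏ s ∈ Finset.univ.erase j, hsinh (q * X j * (X s)⁻¹)) =
      (∏ r, hsinh (q * X j * (Y r)⁻¹ * u⁻¹)) /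
          (∏ s ∈ Finset.univ.erase j, hsinh (X j * (X s)⁻¹)) *
        ((∏ r, hsinh (X j * (Z r)⁻¹ * u)) /
          ∏ s ∈ Finset.univ.erase j, hsinh (q * X j * (X s)⁻¹)) := fun j => by
    rw [div_mul_div_comm, div_mul_div_comm, mul_comm (∏ r, hsinh (X j * (Z r)⁻¹ * u))]
  simp only [hswap, t1, t2]
  rw [Finset.sum_sub_distrib, ← Finset.mul_sum, ← Finset.mul_sum]
  have d3 : ∏ j, X j ≠ 0 := Finset.prod_ne_zero_iff.mpr fun s _ => hX s
  have d4 : ∏ r, Y r ≠ 0 := Finset.prod_ne_zero_iff.mpr fun s _ => hY s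
  have d5 : ∏ r, Z r ≠ 0 := Finset.prod_ne_zero_iff.mpr fun s _ => hZ s
  have hN : ∏ k, (-p k) = (∏ j, X j) ^ 4 := by
    rw [Fintype.prod_sum_type, ← Finset.prod_mul_distrib, ← Finset.prod_pow]
    refine Finset.prod_congr rfl fun j _ => ?_
    simp only [p, Sum.elim_inl, Sum.elim_inr]
    field_simp
  rw [hN] at main
  simp only [zero_add, Finset.prod_pow] at main
  calc _ = (q - q⁻¹) / 4 * ((∏ j, X j) ^ 2 / ((∏ r, Y r) * ∏ r, Z r)) *
      (1 - (∏ r, Y r) ^ 2 * (∏ r, Z r) ^ 2 / (∏ j, X j) ^ 4) := by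
        rw [← main]
        simp only [p, Sum.elim_inl, Sum.elim_inr]
        ring
    _ = _ := by
      field_simp

end PartialFractions

/-! ## Coefficients of the Gelfand–Zetlin operators in exponential variables -/

section Coefficients

theorem Finset.prod_eq_prod_mul_div {κ L : Type*} [Field L] [DecidableEq κ] {T : Finset κ}
    {f g : κ → L} {r : κ} (hr : r ∈ T) (hf : f r ≠ 0) (h : ∀ s ∈ T, s ≠ r → g s = f s) :
    ∏ s ∈ T, g s = (∏ s ∈ T, f s) * (g r / f r) := by
  rw [← Finset.mul_prod_erase T g hr, ← Finset.mul_prod_erase T f hr,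
    Finset.prod_congr rfl fun s hs => h s (Finset.mem_of_mem_erase hs) (Finset.ne_of_mem_erase hs)]
  field_simp

variable {L : Type} [Field L] [Algebra ℂ L]

/-- The automorphism `σ` multiplies the variable `X n j` by `t` and fixes the other variables. -/
def IsShiftAt (X : (n : ℕ) → Fin n → L) (n : ℕ) (j : Fin n) (t : ℂ) (σ : L ≃ₐ[ℂ] L) : Prop :=
  ∀ (m : ℕ) (k : Fin m),
    σ (X m k) = if m = n ∧ k.val = j.val then algebraMap ℂ L t * X m k else X m k

/-- The squares of the variables of level `n` are not proportional to the square of any other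
variable. -/
def GenericAt (X : (n : ℕ) → Fin n → L) (n : ℕ) : Prop :=
  ∀ (j : Fin n) (m : ℕ) (k : Fin m), ¬(m = n ∧ k.val = j.val) → ∀ d : ℂ,
    algebraMap ℂ L d * X n j ^ 2 ≠ X m k ^ 2

/-- The numerator of the coefficients of `E_{n+1,n+2}`. -/
def numE (X : (n : ℕ) → Fin n → L) (u : ℂ) (n : ℕ) (j : Fin (n + 1)) : L :=
  ∏ r : Fin (n + 2), hsinh (X (n + 1) j * (X (n + 2) r)⁻¹ * (algebraMap ℂ L u)⁻¹)

/-- The numerator of the coefficients of `E_{n+2,n+1}`. -/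
def numF (X : (n : ℕ) → Fin n → L) (u : ℂ) (n : ℕ) (j : Fin (n + 1)) : L :=
  ∏ r : Fin n, hsinh (X (n + 1) j * (X n r)⁻¹ * algebraMap ℂ L u)

/-- The common denominator of the coefficients. -/
def denEF (X : (n : ℕ) → Fin n → L) (n : ℕ) (j : Fin n) : L :=
  ∏ s ∈ Finset.univ.erase j, hsinh (X n j * (X n s)⁻¹)

/-- The coefficients of `E_{n+1,n+2}`. -/
def coefE (X : (n : ℕ) → Fin n → L) (u : ℂ) (n : ℕ) (j : Fin (n + 1)) : L :=
  numE X u n j / denEF X (n + 1) j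

/-- The coefficients of `E_{n+2,n+1}`. -/
def coefF (X : (n : ℕ) → Fin n → L) (u : ℂ) (n : ℕ) (j : Fin (n + 1)) : L :=
  numF X u n j / denEF X (n + 1) j

variable {X : (n : ℕ) → Fin n → L} {n m : ℕ} {t u : ℂ} {σ : L ≃ₐ[ℂ] L}

namespace IsShiftAt

theorem apply_self {j : Fin n} (h : IsShiftAt X n j t σ) :
    σ (X n j) = algebraMap ℂ L t * X n j := by
  rw [h, if_pos ⟨rfl, rfl⟩]

theorem apply_of_ne {j k : Fin n} (h : IsShiftAt X n j t σ) (hjk : k ≠ j) :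
    σ (X n k) = X n k := by
  rw [h, if_neg fun hc => hjk (Fin.ext hc.2)]

theorem apply_of_level_ne {j : Fin n} (h : IsShiftAt X n j t σ) (hm : m ≠ n) (k : Fin m) :
    σ (X m k) = X m k := by
  rw [h, if_neg fun hc => hm hc.1]

end IsShiftAt

namespace GenericAt

/-- The hyperbolic sine vanishes only where its exponential argument squares to 1, and that would
make the two squared variables proportional. -/
theorem hsinh_ne_zero [CharZero L] (hX : GenericAt X n) (h0 : ∀ n j, X n j ≠ 0) (j : Fin n)
    (k : Fin m) (hjk : ¬(m = n ∧ k.val = j.val)) {d : ℂ} (hd : d ≠ 0) :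
    hsinh (X n j * (X m k)⁻¹ * algebraMap ℂ L d) ≠ 0 := by
  have hd' : algebraMap ℂ L d ≠ 0 := by simpa using hd
  refine _root_.hsinh_ne_zero (mul_ne_zero (mul_ne_zero (h0 _ _) (inv_ne_zero (h0 _ _))) hd') ?_
  intro h
  refine hX j m k hjk (d ^ 2) ?_
  have := h0 m k
  rw [map_pow]
  field_simp at h
  linear_combination h

end GenericAt

/-! ### Effect of a shift on the coefficients. -/

theorem numE_eq_of_level_ne {i : Fin m} (h : IsShiftAt X m i t σ) (h1 : m ≠ n + 1)
    (h2 : m ≠ n + 2) (j : Fin (n + 1)) : σ (numE X u n j) = numE X u n j := by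
  simp only [numE, map_prod, map_hsinh, map_mul, map_inv₀, AlgEquiv.commutes,
    h.apply_of_level_ne h1.symm, h.apply_of_level_ne h2.symm]

theorem numF_eq_of_level_ne {i : Fin m} (h : IsShiftAt X m i t σ) (h1 : m ≠ n + 1)
    (h2 : m ≠ n) (j : Fin (n + 1)) : σ (numF X u n j) = numF X u n j := by
  simp only [numF, map_prod, map_hsinh, map_mul, map_inv₀, AlgEquiv.commutes,
    h.apply_of_level_ne h1.symm, h.apply_of_level_ne h2.symm]

theorem denEF_eq_of_level_ne {i : Fin m} (h : IsShiftAt X m i t σ) (h1 : m ≠ n) (j : Fin n) :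
    σ (denEF X n j) = denEF X n j := by
  simp only [denEF, map_prod, map_hsinh, map_mul, map_inv₀, h.apply_of_level_ne h1.symm]

theorem coefE_eq_of_level_ne {i : Fin m} (h : IsShiftAt X m i t σ) (h1 : m ≠ n + 1)
    (h2 : m ≠ n + 2) (j : Fin (n + 1)) : σ (coefE X u n j) = coefE X u n j := by
  rw [coefE, map_div₀, numE_eq_of_level_ne h h1 h2, denEF_eq_of_level_ne h h1]

theorem coefF_eq_of_level_ne {i : Fin m} (h : IsShiftAt X m i t σ) (h1 : m ≠ n + 1)
    (h2 : m ≠ n) (j : Fin (n + 1)) : σ (coefF X u n j) = coefF X u n j := by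
  rw [coefF, map_div₀, numF_eq_of_level_ne h h1 h2, denEF_eq_of_level_ne h h1]

/-- Only the numerator factor indexed by `r` contains the shifted variable. -/
theorem coefE_shift_upper [CharZero L] (h0 : ∀ n j, X n j ≠ 0)
    (hX : GenericAt X (n + 1)) (hu : u ≠ 0)
    {r : Fin (n + 2)} (h : IsShiftAt X (n + 2) r t σ) (j : Fin (n + 1)) :
    σ (coefE X u n j) = coefE X u n j *
      (hsinh (X (n + 1) j * ((X (n + 2) r)⁻¹ * (algebraMap ℂ L u)⁻¹) * (algebraMap ℂ L t)⁻¹) /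
        hsinh (X (n + 1) j * ((X (n + 2) r)⁻¹ * (algebraMap ℂ L u)⁻¹))) := by
  have hn : σ (numE X u n j) = numE X u n j *
      (hsinh (X (n + 1) j * ((X (n + 2) r)⁻¹ * (algebraMap ℂ L u)⁻¹) * (algebraMap ℂ L t)⁻¹) /
        hsinh (X (n + 1) j * ((X (n + 2) r)⁻¹ * (algebraMap ℂ L u)⁻¹))) := by
    have hne := hX.hsinh_ne_zero h0 j r (by omega) (inv_ne_zero hu)
    rw [map_inv₀] at hne
    simp only [numE, map_prod, map_hsinh, map_mul, map_inv₀, AlgEquiv.commutes]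
    rw [Finset.prod_eq_prod_mul_div
      (f := fun r => hsinh (X (n + 1) j * (X (n + 2) r)⁻¹ * (algebraMap ℂ L u)⁻¹))
      (Finset.mem_univ r) hne]
    · simp only [h.apply_of_level_ne (show n + 1 ≠ n + 2 by omega), h.apply_self, mul_assoc,
        mul_inv, mul_comm, mul_left_comm]
    · intro s _ hs
      rw [h.apply_of_level_ne (show n + 1 ≠ n + 2 by omega), h.apply_of_ne hs]
  rw [coefE, map_div₀, hn, denEF_eq_of_level_ne h (by omega)]
  ring

theorem coefF_shift_lower [CharZero L] (h0 : ∀ n j, X n j ≠ 0)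
    (hX : GenericAt X (n + 1)) (hu : u ≠ 0)
    {r : Fin n} (h : IsShiftAt X n r t σ) (j : Fin (n + 1)) :
    σ (coefF X u n j) = coefF X u n j *
      (hsinh (X (n + 1) j * ((X n r)⁻¹ * algebraMap ℂ L u) * (algebraMap ℂ L t)⁻¹) /
        hsinh (X (n + 1) j * ((X n r)⁻¹ * algebraMap ℂ L u))) := by
  have hn : σ (numF X u n j) = numF X u n j *
      (hsinh (X (n + 1) j * ((X n r)⁻¹ * algebraMap ℂ L u) * (algebraMap ℂ L t)⁻¹) /
        hsinh (X (n + 1) j * ((X n r)⁻¹ * algebraMap ℂ L u))) := by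
    have hne := hX.hsinh_ne_zero h0 j r (by omega) hu
    simp only [numF, map_prod, map_hsinh, map_mul, map_inv₀, AlgEquiv.commutes]
    rw [Finset.prod_eq_prod_mul_div
      (f := fun r => hsinh (X (n + 1) j * (X n r)⁻¹ * algebraMap ℂ L u))
      (Finset.mem_univ r) hne]
    · simp only [h.apply_of_level_ne (show n + 1 ≠ n by omega), h.apply_self, mul_assoc,
        mul_inv, mul_comm, mul_left_comm]
    · intro s _ hs
      rw [h.apply_of_level_ne (show n + 1 ≠ n by omega), h.apply_of_ne hs]
  rw [coefF, map_div₀, hn, denEF_eq_of_level_ne h (by omega)]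
  ring

theorem denEF_shift_of_ne [CharZero L] (h0 : ∀ n j, X n j ≠ 0)
    (hX : GenericAt X n) {i j : Fin n}
    (h : IsShiftAt X n i t σ) (hij : i ≠ j) :
    σ (denEF X n j) = denEF X n j *
      (hsinh (X n j * (X n i)⁻¹ * (algebraMap ℂ L t)⁻¹) / hsinh (X n j * (X n i)⁻¹)) := by
  have hne := hX.hsinh_ne_zero h0 j i (fun hc => hij (Fin.ext hc.2)) one_ne_zero
  rw [map_one, mul_one] at hne
  simp only [denEF, map_prod, map_hsinh, map_mul, map_inv₀]
  rw [Finset.prod_eq_prod_mul_div (f := fun s => hsinh (X n j * (X n s)⁻¹))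
    (Finset.mem_erase.mpr ⟨hij, Finset.mem_univ i⟩) hne]
  · simp only [h.apply_of_ne hij.symm, h.apply_self, mul_assoc, mul_inv, mul_comm]
  · intro s _ hs
    rw [h.apply_of_ne hij.symm, h.apply_of_ne hs]

/-- The shifted variable occurs only in the factor `s = i` of the denominator. -/
theorem coefE_shift_of_ne [CharZero L] (h0 : ∀ n j, X n j ≠ 0)
    (hX : GenericAt X (n + 1)) {i j : Fin (n + 1)}
    (h : IsShiftAt X (n + 1) i t σ) (hij : i ≠ j) :
    σ (coefE X u n j) = coefE X u n j * (hsinh (X (n + 1) j * (X (n + 1) i)⁻¹) /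
      hsinh (X (n + 1) j * (X (n + 1) i)⁻¹ * (algebraMap ℂ L t)⁻¹)) := by
  have hn : σ (numE X u n j) = numE X u n j := by
    simp only [numE, map_prod, map_hsinh, map_mul, map_inv₀, AlgEquiv.commutes,
      h.apply_of_ne hij.symm, h.apply_of_level_ne (show n + 2 ≠ n + 1 by omega)]
  rw [coefE, map_div₀, hn, denEF_shift_of_ne h0 hX h hij]
  rw [← div_div, div_eq_mul_inv _ (_ / _), inv_div]

theorem coefF_shift_of_ne [CharZero L] (h0 : ∀ n j, X n j ≠ 0)
    (hX : GenericAt X (n + 1)) {i j : Fin (n + 1)}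
    (h : IsShiftAt X (n + 1) i t σ) (hij : i ≠ j) :
    σ (coefF X u n j) = coefF X u n j * (hsinh (X (n + 1) j * (X (n + 1) i)⁻¹) /
      hsinh (X (n + 1) j * (X (n + 1) i)⁻¹ * (algebraMap ℂ L t)⁻¹)) := by
  have hn : σ (numF X u n j) = numF X u n j := by
    simp only [numF, map_prod, map_hsinh, map_mul, map_inv₀, AlgEquiv.commutes,
      h.apply_of_ne hij.symm, h.apply_of_level_ne (show n ≠ n + 1 by omega)]
  rw [coefF, map_div₀, hn, denEF_shift_of_ne h0 hX h hij]
  rw [← div_div, div_eq_mul_inv _ (_ / _), inv_div]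

theorem coefE_shift_self {j : Fin (n + 1)} (h : IsShiftAt X (n + 1) j t σ) :
    σ (coefE X u n j) =
      (∏ r : Fin (n + 2), hsinh (algebraMap ℂ L t * X (n + 1) j * (X (n + 2) r)⁻¹ *
        (algebraMap ℂ L u)⁻¹)) /
      ∏ s ∈ Finset.univ.erase j, hsinh (algebraMap ℂ L t * X (n + 1) j * (X (n + 1) s)⁻¹) := by
  rw [coefE, map_div₀, denEF, map_prod, Finset.prod_congr rfl fun s hs => by
    rw [map_hsinh, map_mul, map_inv₀, h.apply_of_ne (Finset.ne_of_mem_erase hs), h.apply_self]]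
  simp only [numE, map_prod, map_hsinh, map_mul, map_inv₀, AlgEquiv.commutes,
      h.apply_self, h.apply_of_level_ne (show n + 2 ≠ n + 1 by omega)]

theorem coefF_shift_self {j : Fin (n + 1)} (h : IsShiftAt X (n + 1) j t σ) :
    σ (coefF X u n j) =
      (∏ r : Fin n, hsinh (algebraMap ℂ L t * X (n + 1) j * (X n r)⁻¹ * algebraMap ℂ L u)) /
      ∏ s ∈ Finset.univ.erase j, hsinh (algebraMap ℂ L t * X (n + 1) j * (X (n + 1) s)⁻¹) := by
  rw [coefF, map_div₀, denEF, map_prod, Finset.prod_congr rfl fun s hs => by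
    rw [map_hsinh, map_mul, map_inv₀, h.apply_of_ne (Finset.ne_of_mem_erase hs), h.apply_self]]
  simp only [numF, map_prod, map_hsinh, map_mul, map_inv₀, AlgEquiv.commutes,
      h.apply_self, h.apply_of_level_ne (show n ≠ n + 1 by omega)]

/-! ### Sign changes -/

theorem prod_hsinh_neg {κ L : Type*} [Field L] (T : Finset κ) (f : κ → L) :
    ∏ s ∈ T, hsinh (-f s) = (-1) ^ T.card * ∏ s ∈ T, hsinh (f s) := by
  simp only [hsinh_neg, Finset.prod_neg]

/-- Every factor changes sign: n + 2 of them in the numerator and n in the denominator, so the signs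
cancel. -/
theorem coefE_neg_self {j : Fin (n + 1)} (h : IsShiftAt X (n + 1) j (-1) σ) :
    σ (coefE X u n j) = coefE X u n j := by
  rw [coefE_shift_self h]
  simp only [map_neg, map_one, neg_mul, one_mul, prod_hsinh_neg,
    Finset.card_erase_of_mem (Finset.mem_univ j), Finset.card_univ, Fintype.card_fin,
    Nat.add_sub_cancel, pow_add]
  rw [neg_one_sq, mul_one, mul_div_mul_left _ _ (pow_ne_zero _ (neg_ne_zero.mpr one_ne_zero))]
  rfl

theorem coefF_neg_self {j : Fin (n + 1)} (h : IsShiftAt X (n + 1) j (-1) σ) :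
    σ (coefF X u n j) = coefF X u n j := by
  rw [coefF_shift_self h]
  simp only [map_neg, map_one, neg_mul, one_mul, prod_hsinh_neg,
    Finset.card_erase_of_mem (Finset.mem_univ j), Finset.card_univ, Fintype.card_fin,
    Nat.add_sub_cancel]
  rw [mul_div_mul_left _ _ (pow_ne_zero _ (neg_ne_zero.mpr one_ne_zero))]
  rfl

theorem coefE_neg_of_ne [CharZero L] (h0 : ∀ n j, X n j ≠ 0)
    (hX : GenericAt X (n + 1)) {i j : Fin (n + 1)}
    (h : IsShiftAt X (n + 1) i (-1) σ) (hij : i ≠ j) :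
    σ (coefE X u n j) = -coefE X u n j := by
  have hne := hX.hsinh_ne_zero h0 j i (fun hc => hij (Fin.ext hc.2)) one_ne_zero
  rw [map_one, mul_one] at hne
  rw [coefE_shift_of_ne h0 hX h hij, map_neg, map_one, inv_neg, inv_one, mul_neg_one, hsinh_neg,
    div_neg, div_self hne, mul_neg_one]

theorem coefF_neg_of_ne [CharZero L] (h0 : ∀ n j, X n j ≠ 0)
    (hX : GenericAt X (n + 1)) {i j : Fin (n + 1)}
    (h : IsShiftAt X (n + 1) i (-1) σ) (hij : i ≠ j) :
    σ (coefF X u n j) = -coefF X u n j := by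
  have hne := hX.hsinh_ne_zero h0 j i (fun hc => hij (Fin.ext hc.2)) one_ne_zero
  rw [map_one, mul_one] at hne
  rw [coefF_shift_of_ne h0 hX h hij, map_neg, map_one, inv_neg, inv_one, mul_neg_one, hsinh_neg,
    div_neg, div_self hne, mul_neg_one]

theorem coefE_neg_upper [CharZero L] (h0 : ∀ n j, X n j ≠ 0)
    (hX : GenericAt X (n + 1)) (hu : u ≠ 0)
    {r : Fin (n + 2)} (h : IsShiftAt X (n + 2) r (-1) σ) (j : Fin (n + 1)) :
    σ (coefE X u n j) = -coefE X u n j := by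
  have hne := hX.hsinh_ne_zero h0 j r (by omega) (inv_ne_zero hu)
  rw [map_inv₀, mul_assoc] at hne
  rw [coefE_shift_upper h0 hX hu h, map_neg, map_one, inv_neg, inv_one, mul_neg_one, hsinh_neg,
    neg_div, div_self hne, mul_neg_one]

theorem coefF_neg_lower [CharZero L] (h0 : ∀ n j, X n j ≠ 0)
    (hX : GenericAt X (n + 1)) (hu : u ≠ 0)
    {r : Fin n} (h : IsShiftAt X n r (-1) σ) (j : Fin (n + 1)) :
    σ (coefF X u n j) = -coefF X u n j := by
  have hne := hX.hsinh_ne_zero h0 j r (by omega) hu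
  rw [mul_assoc] at hne
  rw [coefF_shift_lower h0 hX hu h, map_neg, map_one, inv_neg, inv_one, mul_neg_one, hsinh_neg,
    neg_div, div_self hne, mul_neg_one]

end Coefficients

/-! ## Serre relations for sums of difference operators -/

namespace MerFn

section Serre

variable {ι : Type} [Fintype ι] {κ κ' : Type}

instance : CharZero (MerFn ι) := charZero_of_injective_algebraMap (algebraMap ℂ (MerFn ι)).injective

variable {a : κ → MerFn ι} {v : κ → ι → ℂ} {b : κ' → MerFn ι} {w : κ' → ι → ℂ} {t : ℂ}
  {X : κ → MerFn ι} {y : κ' → MerFn ι}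

theorem serreCoeff_symm_eq_zero (ht : t ≠ 0) (hX0 : ∀ i, X i ≠ 0) (hy0 : ∀ k, y k ≠ 0)
    (hXX : ∀ i j, i ≠ j → hsinh (X j * (X i)⁻¹ * (algebraMap ℂ (MerFn ι) t)⁻¹) ≠ 0)
    (hXy : ∀ i k, ∀ d : ℂ, d ≠ 0 → hsinh (X i * y k * algebraMap ℂ (MerFn ι) d) ≠ 0)
    (hX : ∀ i, shift (v i) (X i) = algebraMap ℂ (MerFn ι) t * X i)
    (hX' : ∀ i j, i ≠ j → shift (v i) (X j) = X j) (hy : ∀ i k, shift (v i) (y k) = y k)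
    (ha : ∀ i j, i ≠ j → shift (v i) (a j) = a j * (hsinh (X j * (X i)⁻¹) /
      hsinh (X j * (X i)⁻¹ * (algebraMap ℂ (MerFn ι) t)⁻¹)))
    (hb : ∀ i k, shift (v i) (b k) = b k)
    (hw : ∀ i k, shift (w k) (a i) = a i *
      (hsinh (X i * y k * (algebraMap ℂ (MerFn ι) t)⁻¹) / hsinh (X i * y k)))
    (i j : κ) (k : κ') :
    serreCoeff a v b w (t + t⁻¹) i j k + serreCoeff a v b w (t + t⁻¹) j i k = 0 := by
  have hXy1 : ∀ i k, hsinh (X i * y k) ≠ 0 := fun i k => by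
    simpa using hXy i k 1 one_ne_zero
  have ht' : algebraMap ℂ (MerFn ι) t ≠ 0 := by simpa using ht
  simp only [serreCoeff, hb, hw, map_mul, map_div₀, map_hsinh, map_inv₀, AlgEquiv.commutes, hy,
    Algebra.smul_def, map_add]
  have hc : ∀ i k, X i * y k ≠ 0 := fun i k => mul_ne_zero (hX0 i) (hy0 k)
  -- On the diagonal the two shifts leave three consecutive values `A`, `B`, `C` of `hsinh`, at
  -- arguments in ratio t, and the coefficient is a multiple of A - (t + t⁻¹) B + C.
  by_cases hij : i = j
  · subst hij
    rw [hX]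
    have h2 := hXy i k t ht
    have h3 := hsinh_mul_add_hsinh_div ht' (hc i k)
    have e1 : algebraMap ℂ (MerFn ι) t * X i * y k * (algebraMap ℂ (MerFn ι) t)⁻¹ = X i * y k := by
      field_simp
    have e2 : algebraMap ℂ (MerFn ι) t * X i * y k = algebraMap ℂ (MerFn ι) t * (X i * y k) := by
      ring
    rw [e1, e2]
    rw [mul_comm _ (algebraMap ℂ (MerFn ι) t)] at h2
    have h4 := hXy1 i k
    generalize hsinh (algebraMap ℂ (MerFn ι) t * (X i * y k)) = A at *
    generalize hsinh (X i * y k) = B at *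
    generalize hsinh (X i * y k * (algebraMap ℂ (MerFn ι) t)⁻¹) = C at *
    generalize algebraMap ℂ (MerFn ι) t + (algebraMap ℂ (MerFn ι) t)⁻¹ = T at *
    generalize shift (v i) (a i) = D at *
    field_simp
    linear_combination 2 * a i * b k * D * h3
  -- For distinct indices the two-point identity applies to `X i * y k` and `X j * y k`, whose ratio
  -- does not involve `y k`.
  · have e1 : X j * y k * (X i * y k)⁻¹ = X j * (X i)⁻¹ := by
      have := hy0 k
      have := hX0 i
      field_simp
    have e2 : X i * y k * (X j * y k)⁻¹ = X i * (X j)⁻¹ := by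
      have := hy0 k
      have := hX0 j
      field_simp
    have h := serre_pair_eq_zero (hc i k) (hc j k) ht' (hXy1 i k) (hXy1 j k)
      (by rw [e2]; exact hXX j i (Ne.symm hij)) (by rw [e1]; exact hXX i j hij)
    rw [e1, e2] at h
    rw [hX' i j hij, hX' j i (Ne.symm hij), ha i j hij, ha j i (Ne.symm hij)]
    linear_combination a i * a j * b k * h

theorem serreCoeff_symm_eq_zero' (ht : t ≠ 0) (hX0 : ∀ i, X i ≠ 0) (hy0 : ∀ k, y k ≠ 0)
    (hXX : ∀ i j, i ≠ j → hsinh (X j * (X i)⁻¹ * (algebraMap ℂ (MerFn ι) t)⁻¹) ≠ 0)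
    (hXy : ∀ i k, ∀ d : ℂ, d ≠ 0 → hsinh (y k * (X i)⁻¹ * algebraMap ℂ (MerFn ι) d) ≠ 0)
    (hX : ∀ i, shift (v i) (X i) = algebraMap ℂ (MerFn ι) t * X i)
    (hX' : ∀ i j, i ≠ j → shift (v i) (X j) = X j) (hy : ∀ i k, shift (v i) (y k) = y k)
    (ha : ∀ i j, i ≠ j → shift (v i) (a j) = a j * (hsinh (X j * (X i)⁻¹) /
      hsinh (X j * (X i)⁻¹ * (algebraMap ℂ (MerFn ι) t)⁻¹)))
    (hb : ∀ i k, shift (v i) (b k) = b k *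
      (hsinh (y k * (X i)⁻¹ * (algebraMap ℂ (MerFn ι) t)⁻¹) / hsinh (y k * (X i)⁻¹)))
    (hw : ∀ i k, shift (w k) (a i) = a i)
    (i j : κ) (k : κ') :
    serreCoeff a v b w (t + t⁻¹) i j k + serreCoeff a v b w (t + t⁻¹) j i k = 0 := by
  have hXy1 : ∀ i k, hsinh (y k * (X i)⁻¹) ≠ 0 := fun i k => by
    simpa using hXy i k 1 one_ne_zero
  have ht' : algebraMap ℂ (MerFn ι) t ≠ 0 := by simpa using ht
  simp only [serreCoeff, hb, hw, map_mul, map_div₀, map_hsinh, map_inv₀, AlgEquiv.commutes, hy,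
    Algebra.smul_def, map_add]
  have hc : ∀ i k, y k * (X i)⁻¹ ≠ 0 := fun i k => mul_ne_zero (hy0 k) (inv_ne_zero (hX0 i))
  by_cases hij : i = j
  · subst hij
    rw [hX]
    have h2 := hXy i k t⁻¹ (inv_ne_zero ht)
    rw [map_inv₀] at h2
    have h4 := hXy1 i k
    -- Here the shifts act on `b k`, so the middle one of the three consecutive arguments is the
    -- once-shifted one.
    set x := y k * (X i)⁻¹ * (algebraMap ℂ (MerFn ι) t)⁻¹ with hx
    have hx0 : x ≠ 0 := mul_ne_zero (hc i k) (inv_ne_zero ht')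
    have h3 := hsinh_mul_add_hsinh_div ht' hx0
    have e1 : algebraMap ℂ (MerFn ι) t * x = y k * (X i)⁻¹ := by
      rw [hx]
      field_simp
    have e2 : y k * (algebraMap ℂ (MerFn ι) t * X i)⁻¹ = x := by
      rw [hx, mul_inv]
      ring
    rw [e2]
    rw [e1] at h3
    generalize hsinh (y k * (X i)⁻¹) = A at *
    generalize hsinh x = B at *
    generalize hsinh (x * (algebraMap ℂ (MerFn ι) t)⁻¹) = C at *
    generalize algebraMap ℂ (MerFn ι) t + (algebraMap ℂ (MerFn ι) t)⁻¹ = T at *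
    generalize shift (v i) (a i) = D at *
    field_simp
    linear_combination 2 * a i * b k * D * h3
  · have e1 : y k * (X i)⁻¹ * (y k * (X j)⁻¹)⁻¹ = X j * (X i)⁻¹ := by
      have := hy0 k
      have := hX0 i
      have := hX0 j
      field_simp
    have e2 : y k * (X j)⁻¹ * (y k * (X i)⁻¹)⁻¹ = X i * (X j)⁻¹ := by
      have := hy0 k
      have := hX0 i
      have := hX0 j
      field_simp
    have h := serre_pair_eq_zero' (hc i k) (hc j k) ht' (hXy1 i k) (hXy1 j k)
      (by rw [e2]; exact hXX j i (Ne.symm hij)) (by rw [e1]; exact hXX i j hij)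
    rw [e1, e2] at h
    rw [hX' i j hij, hX' j i (Ne.symm hij), ha i j hij, ha j i (Ne.symm hij)]
    linear_combination a i * a j * b k * h

end Serre

end MerFn

/-! ## The Gelfand–Zetlin variables -/

namespace EntireFn

variable {ι : Type} [Fintype ι]

theorem exp_add (f g : EntireFn ι) : exp (f + g) = exp f * exp g :=
  Subtype.ext (funext fun x => Complex.exp_add (f.1 x) (g.1 x))

theorem exp_zero : exp (0 : EntireFn ι) = 1 :=
  Subtype.ext (funext fun _ => Complex.exp_zero)

theorem exp_const (a : ℂ) : exp (const a : EntireFn ι) = const (Complex.exp a) := rfl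

theorem sinh_eq (f : EntireFn ι) : const 2 * sinh f = exp f - exp (-f) :=
  Subtype.ext (funext fun x => Complex.two_sinh (f.1 x))

theorem translate_exp (v : ι → ℂ) (f : EntireFn ι) :
    translate v (exp f) = exp (translate v f) := rfl

theorem translate_coord (v : ι → ℂ) (i : ι) :
    translate v (coord i) = coord i + const (v i) := rfl

theorem translate_const (v : ι → ℂ) (a : ℂ) :
    translate v (const a : EntireFn ι) = const a := rfl

end EntireFn

namespace MerFn

variable {ι : Type} [Fintype ι]

/-- `exp ((π / ω) f)` as a meromorphic function. -/
noncomputable def expScaled (ω : ℂ) (f : EntireFn ι) : MerFn ι :=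
  ofEntire (EntireFn.exp (((Real.pi : ℂ) / ω) • f))

theorem expScaled_add (ω : ℂ) (f g : EntireFn ι) :
    expScaled ω (f + g) = expScaled ω f * expScaled ω g := by
  simp only [expScaled, smul_add, EntireFn.exp_add, ofEntire, map_mul]

theorem expScaled_zero (ω : ℂ) : expScaled ω (0 : EntireFn ι) = 1 := by
  simp only [expScaled, smul_zero, EntireFn.exp_zero, ofEntire, map_one]

theorem expScaled_ne_zero (ω : ℂ) (f : EntireFn ι) : expScaled ω f ≠ 0 := by
  intro h
  have h1 := expScaled_add ω f (-f)
  rw [add_neg_cancel, expScaled_zero, h, zero_mul] at h1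
  exact one_ne_zero h1

theorem expScaled_neg (ω : ℂ) (f : EntireFn ι) : expScaled ω (-f) = (expScaled ω f)⁻¹ := by
  apply eq_inv_of_mul_eq_one_left
  rw [← expScaled_add, neg_add_cancel, expScaled_zero]

theorem expScaled_sub (ω : ℂ) (f g : EntireFn ι) :
    expScaled ω (f - g) = expScaled ω f * (expScaled ω g)⁻¹ := by
  rw [sub_eq_add_neg, expScaled_add, expScaled_neg]

theorem expScaled_sum {κ : Type*} (ω : ℂ) (s : Finset κ) (f : κ → EntireFn ι) :
    expScaled ω (∑ i ∈ s, f i) = ∏ i ∈ s, expScaled ω (f i) := by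
  classical
  induction s using Finset.induction_on with
  | empty => simp [expScaled_zero]
  | insert i s hi ih => rw [Finset.sum_insert hi, Finset.prod_insert hi, expScaled_add, ih]

theorem ofEntire_const (a : ℂ) :
    ofEntire (EntireFn.const a : EntireFn ι) = algebraMap ℂ (MerFn ι) a :=
  (IsScalarTower.algebraMap_apply ℂ (EntireFn ι) (MerFn ι) a).symm

theorem expScaled_const (ω a : ℂ) :
    expScaled ω (EntireFn.const a : EntireFn ι) =
      algebraMap ℂ (MerFn ι) (Complex.exp (Real.pi / ω * a)) := by
  rw [← ofEntire_const, ← EntireFn.exp_const]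
  rfl

theorem shift_expScaled (v : ι → ℂ) (ω : ℂ) (f : EntireFn ι) :
    shift v (expScaled ω f) = expScaled ω (EntireFn.translate v f) := by
  rw [expScaled, shift_ofEntire, EntireFn.translate_exp, map_smul]
  rfl

end MerFn

section GZVariables

open MerFn

variable {N : ℕ} (c : Fin N → ℂ)

theorem gzSinh_eq (ω : ℂ) (f : EntireFn (GZIndex N)) (a : ℂ) :
    gzSinh ω f a = hsinh (expScaled ω f *
      algebraMap ℂ (GZSpace N) (Complex.exp (Real.pi / ω * a))) := by
  have h := congrArg ofEntire (EntireFn.sinh_eq (((Real.pi : ℂ) / ω) • (f + EntireFn.const a)))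
  have h2 : ofEntire (EntireFn.const 2 : EntireFn (GZIndex N)) = 2 := by
    rw [ofEntire_const, map_ofNat]
  simp only [ofEntire, map_mul, map_sub] at h h2
  rw [h2, ← smul_neg] at h
  change 2 * gzSinh ω f a = expScaled ω (f + EntireFn.const a) -
    expScaled ω (-(f + EntireFn.const a)) at h
  rw [← expScaled_const, ← expScaled_add, hsinh, ← expScaled_neg, ← h]
  ring

/-- The variable `γ_{n,j}`, for all `n`: `0` for `n > N`. -/
noncomputable def gzVar (n : ℕ) (j : Fin n) : EntireFn (GZIndex N) :=
  if h : n ≤ N then gzGamma c n h j else 0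

theorem gzVar_eq {n : ℕ} (hn : n ≤ N) (j : Fin n) : gzVar c n j = gzGamma c n hn j := dif_pos hn

/-- The exponential `exp (π γ_{n,j} / ω)`. -/
noncomputable def gzX (ω : ℂ) (n : ℕ) (j : Fin n) : GZSpace N := expScaled ω (gzVar c n j)

/-- The translation vector along the variable `γ_{n,j}`. -/
noncomputable def gzVec {n : ℕ} (hn : n < N) (a : ℂ) (j : Fin n) : GZIndex N → ℂ :=
  Pi.single (⟨⟨n, hn⟩, j⟩ : GZIndex N) a

theorem translate_gzVar {n : ℕ} (hn : n < N) (a : ℂ) (j : Fin n) (m : ℕ) (k : Fin m) :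
    EntireFn.translate (gzVec hn a j) (gzVar c m k) =
      if m = n ∧ k.val = j.val then gzVar c m k + EntireFn.const a else gzVar c m k := by
  by_cases hm : m < N
  · rw [gzVar_eq c hm.le, gzGamma, dif_pos hm, EntireFn.translate_coord, gzVec]
    by_cases h : m = n ∧ k.val = j.val
    · obtain ⟨rfl, hk⟩ := h
      obtain rfl := Fin.ext hk
      rw [if_pos ⟨rfl, rfl⟩, Pi.single_eq_same]
    · rw [if_neg h, Pi.single_eq_of_ne]
      · exact (congrArg _ (map_zero (algebraMap ℂ (EntireFn (GZIndex N))))).trans (add_zero _)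
      · intro hc
        rw [Sigma.mk.injEq, Fin.mk.injEq] at hc
        obtain ⟨rfl, hk⟩ := hc
        exact h ⟨rfl, congrArg Fin.val (eq_of_heq hk)⟩
  -- From level N on there are only the constant parameters or the default value 0, both fixed by
  -- translations.
  · rw [if_neg fun hc : m = n ∧ k.val = j.val => hm (hc.1 ▸ hn)]
    by_cases hm' : m ≤ N
    · rw [gzVar_eq c hm', gzGamma, dif_neg hm, EntireFn.translate_const]
    · rw [gzVar, dif_neg hm', map_zero]

theorem gzX_ne_zero (ω : ℂ) (n : ℕ) (j : Fin n) : gzX c ω n j ≠ 0 := expScaled_ne_zero _ _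

theorem isShiftAt_gzX (ω : ℂ) {n : ℕ} (hn : n < N) (a : ℂ) (j : Fin n) :
    IsShiftAt (gzX c ω) n j (Complex.exp (Real.pi / ω * a)) (shift (gzVec hn a j)) := by
  intro m k
  rw [gzX, shift_expScaled, translate_gzVar]
  split_ifs
  · rw [expScaled_add, expScaled_const, mul_comm]
  · rfl

/-- The translation by ω multiplies `X n j` by exp π and fixes the other variable, so a
proportionality of squares would force exp(2π) = 1. -/
theorem genericAt_gzX {ω : ℂ} (hω : ω ≠ 0) {n : ℕ} (hn : n < N) : GenericAt (gzX c ω) n := by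
  intro j m k hjk d h
  have hs := isShiftAt_gzX c ω hn ω j
  have h' := congrArg (shift (gzVec hn ω j)) h
  rw [map_mul, map_pow, map_pow, AlgEquiv.commutes, hs.apply_self, hs m k, if_neg hjk, ← h] at h'
  have hd : algebraMap ℂ (GZSpace N) d ≠ 0 := by
    intro hd
    rw [hd, zero_mul] at h
    exact pow_ne_zero 2 (gzX_ne_zero c ω m k) h.symm
  have h2 := mul_left_cancel₀ hd h'
  rw [mul_pow] at h2
  have h3 := mul_right_cancel₀ (pow_ne_zero 2 (gzX_ne_zero c ω n j)) (h2.trans (one_mul _).symm)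
  rw [← map_pow, ← map_one (algebraMap ℂ (GZSpace N)), div_mul_cancel₀ _ hω] at h3
  have h4 := (algebraMap ℂ (GZSpace N)).injective h3
  rw [← Complex.ofReal_exp] at h4
  norm_cast at h4
  have h5 : 1 < Real.exp Real.pi := Real.one_lt_exp_iff.mpr Real.pi_pos
  nlinarith

/-- The constant `exp (π i (ω₁ + ω₂) / (2 ω₂))`. -/
noncomputable def gzU (ω₁ ω₂ : ℂ) : ℂ := Complex.exp (Real.pi / ω₂ * (Complex.I / 2 * (ω₁ + ω₂)))

theorem gzU_ne_zero (ω₁ ω₂ : ℂ) : gzU ω₁ ω₂ ≠ 0 := Complex.exp_ne_zero _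

theorem gzU_sq {ω₁ ω₂ : ℂ} (hω₂ : ω₂ ≠ 0) : gzU ω₁ ω₂ ^ 2 = -qParam ω₁ ω₂ := by
  rw [gzU, qParam, ← Complex.exp_nat_mul, neg_eq_neg_one_mul, ← Complex.exp_pi_mul_I,
    ← Complex.exp_add]
  congr 1
  push_cast
  field_simp
  ring

/-- The operator `E_{n+1,n+2}` without its scalar factor. -/
noncomputable def gzEcore (ω₁ ω₂ : ℂ) (n : ℕ) (hn : n + 1 < N) : Module.End ℂ (GZSpace N) :=
  diffSum (coefE (gzX c ω₂) (gzU ω₁ ω₂) n) (gzVec hn (-(Complex.I * ω₁)))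

/-- The operator `E_{n+2,n+1}` without its scalar factor. -/
noncomputable def gzFcore (ω₁ ω₂ : ℂ) (n : ℕ) (hn : n + 1 < N) : Module.End ℂ (GZSpace N) :=
  diffSum (coefF (gzX c ω₂) (gzU ω₁ ω₂) n) (gzVec hn (Complex.I * ω₁))

/-- The function by which `K_{n+1}` multiplies. -/
noncomputable def gzKfun (ω : ℂ) (n : ℕ) : GZSpace N :=
  (∏ j, gzX c ω (n + 1) j) * (∏ j, gzX c ω n j)⁻¹

theorem gzDenom_eq (ω : ℂ) {n : ℕ} (hn : n ≤ N) (j : Fin n) :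
    gzDenom c ω n hn j = denEF (gzX c ω) n j := by
  refine Finset.prod_congr rfl fun s _ => ?_
  rw [gzSinh_eq, mul_zero, Complex.exp_zero, map_one, mul_one, expScaled_sub, gzX, gzX,
    gzVar_eq c hn, gzVar_eq c hn]

theorem gzE_eq (ω₁ ω₂ : ℂ) (n : Fin (N - 1)) :
    gzE c ω₁ ω₂ n =
      (2 * Complex.exp (Real.pi * Complex.I * (ω₁ + ω₂) * (n.val : ℂ) / (2 * ω₂)) /
        (qParam ω₁ ω₂ - (qParam ω₁ ω₂)⁻¹)) • gzEcore c ω₁ ω₂ n.val (by omega) := by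
  rw [gzE, gzEcore, diffSum]
  congr 1
  refine Finset.sum_congr rfl fun j _ => ?_
  rw [diffOp, gzDenom_eq, coefE, numE]
  congr 3
  refine Finset.prod_congr rfl fun r _ => ?_
  rw [gzSinh_eq, expScaled_sub, gzX, gzX, gzVar_eq c (by omega), gzVar_eq c (by omega), gzU,
    mul_neg, Complex.exp_neg, map_inv₀]

theorem gzF_eq (ω₁ ω₂ : ℂ) (n : Fin (N - 1)) :
    gzF c ω₁ ω₂ n =
      (2 * Complex.exp (-(Real.pi * Complex.I * (ω₁ + ω₂) * (n.val : ℂ) / (2 * ω₂))) /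
        (qParam ω₁ ω₂ - (qParam ω₁ ω₂)⁻¹)) • gzFcore c ω₁ ω₂ n.val (by omega) := by
  rw [gzF, gzFcore, diffSum]
  congr 1
  refine Finset.sum_congr rfl fun j _ => ?_
  rw [diffOp, gzDenom_eq, coefF, numF]
  congr 3
  refine Finset.prod_congr rfl fun r _ => ?_
  rw [gzSinh_eq, expScaled_sub, gzX, gzX, gzVar_eq c (by omega), gzVar_eq c (by omega), gzU]

theorem gzK_eq (ω : ℂ) (n : Fin N) : gzK c ω n = mulOp (gzKfun c ω n.val) := by
  rw [gzK, gzKfun]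
  congr 1
  change expScaled ω _ = _
  rw [expScaled_sub, expScaled_sum, expScaled_sum]
  congr 1
  · refine Finset.prod_congr rfl fun j _ => ?_
    rw [gzX, gzVar_eq c (by omega)]
  · congr 1
    refine Finset.prod_congr rfl fun j _ => ?_
    rw [gzX, gzVar_eq c (by omega)]

theorem gzKfun_ne_zero (ω : ℂ) (n : ℕ) : gzKfun c ω n ≠ 0 :=
  mul_ne_zero (Finset.prod_ne_zero_iff.mpr fun _ _ => gzX_ne_zero _ _ _ _)
    (inv_ne_zero (Finset.prod_ne_zero_iff.mpr fun _ _ => gzX_ne_zero _ _ _ _))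

end GZVariables

/-! ## Relations between the Gelfand–Zetlin operators -/

section GZRelations

open MerFn

theorem qParam_ne_zero (ω₁ ω₂ : ℂ) : qParam ω₁ ω₂ ≠ 0 := Complex.exp_ne_zero _

variable {N : ℕ} (c : Fin N → ℂ)

theorem isShiftAt_gzX_pos (ω₁ ω₂ : ℂ) {n : ℕ} (hn : n < N) (j : Fin n) :
    IsShiftAt (gzX c ω₂) n j (qParam ω₁ ω₂) (shift (gzVec hn (Complex.I * ω₁) j)) := by
  convert isShiftAt_gzX c ω₂ hn (Complex.I * ω₁) j using 1
  rw [qParam]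
  congr 1
  ring

theorem isShiftAt_gzX_neg (ω₁ ω₂ : ℂ) {n : ℕ} (hn : n < N) (j : Fin n) :
    IsShiftAt (gzX c ω₂) n j (qParam ω₁ ω₂)⁻¹ (shift (gzVec hn (-(Complex.I * ω₁)) j)) := by
  convert isShiftAt_gzX c ω₂ hn (-(Complex.I * ω₁)) j using 1
  rw [qParam, ← Complex.exp_neg]
  congr 1
  ring

/-- Taking both periods equal describes how the shifts of one family act on the exponentials used by
the other: by a sign. -/
theorem qParam_self {ω : ℂ} (hω : ω ≠ 0) : qParam ω ω = -1 := by
  rw [qParam, mul_div_assoc, div_self hω, mul_one, Complex.exp_pi_mul_I]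

theorem isShiftAt_gzX_dual_pos {ω : ℂ} (hω : ω ≠ 0) {n : ℕ} (hn : n < N) (j : Fin n) :
    IsShiftAt (gzX c ω) n j (-1) (shift (gzVec hn (Complex.I * ω) j)) := by
  simpa only [qParam_self hω] using isShiftAt_gzX_pos c ω ω hn j

theorem isShiftAt_gzX_dual_neg {ω : ℂ} (hω : ω ≠ 0) {n : ℕ} (hn : n < N) (j : Fin n) :
    IsShiftAt (gzX c ω) n j (-1) (shift (gzVec hn (-(Complex.I * ω)) j)) := by
  simpa only [qParam_self hω, inv_neg, inv_one] using isShiftAt_gzX_neg c ω ω hn j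

/-! ### Relations with the Cartan generators -/

theorem IsShiftAt.map_prod {L : Type} [Field L] [Algebra ℂ L] {X : (n : ℕ) → Fin n → L}
    {m : ℕ} {i : Fin m} {t : ℂ} {σ : L ≃ₐ[ℂ] L} (h : IsShiftAt X m i t σ) (n : ℕ) :
    σ (∏ j, X n j) = algebraMap ℂ L (if n = m then t else 1) * ∏ j, X n j := by
  rw [_root_.map_prod]
  split_ifs with hn
  · subst hn
    rw [← Finset.mul_prod_erase _ _ (Finset.mem_univ i),
      ← Finset.mul_prod_erase _ (X n) (Finset.mem_univ i), h.apply_self, mul_assoc,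
      Finset.prod_congr rfl fun s hs => h.apply_of_ne (Finset.ne_of_mem_erase hs)]
  · simp only [h.apply_of_level_ne hn, map_one, one_mul]

theorem shift_gzKfun {ω t : ℂ} {m : ℕ} {i : Fin (m + 1)} {σ : GZSpace N ≃ₐ[ℂ] GZSpace N}
    (h : IsShiftAt (gzX c ω) (m + 1) i t σ) (n : ℕ) :
    σ (gzKfun c ω n) = t ^ ((kron n m : ℤ) - (kron n (m + 1) : ℤ)) • gzKfun c ω n := by
  rw [gzKfun, map_mul, map_inv₀, h.map_prod, h.map_prod, Algebra.smul_def, mul_inv, ← map_inv₀,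
    mul_mul_mul_comm, ← map_mul]
  congr 2
  simp only [kron]
  by_cases h1 : n = m
  · subst h1
    simp
  · by_cases h2 : n = m + 1
    · subst h2
      simp
    · simp [h1, h2]

theorem gzKfun_mul_diffSum {ω t : ℂ} {m : ℕ} (ht : t ≠ 0) (a : Fin (m + 1) → GZSpace N)
    (v : Fin (m + 1) → GZIndex N → ℂ)
    (h : ∀ i, IsShiftAt (gzX c ω) (m + 1) i t (shift (v i))) (n : ℕ) :
    mulOp (gzKfun c ω n) * diffSum a v =
      t ^ ((kron n (m + 1) : ℤ) - (kron n m : ℤ)) • (diffSum a v * mulOp (gzKfun c ω n)) := by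
  rw [diffSum_mul_mulOp a v _ _ fun i => shift_gzKfun c (h i) n, smul_smul, ← zpow_add₀ ht]
  simp

theorem diffSum_mul_gzKfun_dual {ω : ℂ} {m : ℕ} (a : Fin (m + 1) → GZSpace N)
    (v : Fin (m + 1) → GZIndex N → ℂ)
    (h : ∀ i, IsShiftAt (gzX c ω) (m + 1) i (-1) (shift (v i))) (n : ℕ) :
    diffSum a v * mulOp (gzKfun c ω n) =
      (-1 : ℂ) ^ (kron m n + kron (m + 1) n) • (mulOp (gzKfun c ω n) * diffSum a v) := by
  rw [diffSum_mul_mulOp a v _ _ fun i => shift_gzKfun c (h i) n]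
  congr 1
  -- For powers of -1, the difference and the sum of the exponents have the same effect.
  simp only [kron, eq_comm (a := n)]
  split_ifs <;> simp

/-! ### Commutation relations between the two families -/

/-- Signs are counted term by term. At equal levels both coefficients flip if `i ≠ k` and neither
does if `i = k`. At adjacent levels only the coefficient of lower level flips, which gives the sign
-1. -/
theorem gzEcore_mul_gzEcore_dual {ω₁ ω₂ : ℂ} (hω₁ : ω₁ ≠ 0) (hω₂ : ω₂ ≠ 0) {n m : ℕ}
    (hn : n + 1 < N) (hm : m + 1 < N) :
    gzEcore c ω₁ ω₂ n hn * gzEcore c ω₂ ω₁ m hm =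
      (-1 : ℂ) ^ (kron n (m + 1) + kron (n + 1) m) •
        (gzEcore c ω₂ ω₁ m hm * gzEcore c ω₁ ω₂ n hn) := by
  refine diffSum_comm _ _ _ _ _ fun i k => ?_
  have h1 := isShiftAt_gzX_dual_neg c hω₁ hn i
  have h2 := isShiftAt_gzX_dual_neg c hω₂ hm k
  have g1 := genericAt_gzX c hω₁ hm
  have g2 := genericAt_gzX c hω₂ hn
  by_cases e1 : n = m
  · subst e1
    rw [kron, kron, if_neg (by omega), if_neg (by omega), add_zero, pow_zero, one_smul]
    by_cases hik : i = k
    · subst hik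
      rw [coefE_neg_self h1, coefE_neg_self h2, mul_comm]
    · rw [coefE_neg_of_ne (gzX_ne_zero c _) g1 h1 hik,
        coefE_neg_of_ne (gzX_ne_zero c _) g2 h2 (Ne.symm hik)]
      ring
  by_cases e2 : m = n + 1
  · subst e2
    rw [kron, kron, if_neg (by omega), if_pos rfl, zero_add, pow_one, neg_one_smul,
      coefE_eq_of_level_ne h1 (by omega) (by omega),
      coefE_neg_upper (gzX_ne_zero c _) g2 (gzU_ne_zero _ _) h2]
    ring
  by_cases e3 : n = m + 1
  · subst e3
    rw [kron, kron, if_pos rfl, if_neg (by omega), add_zero, pow_one, neg_one_smul,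
      coefE_eq_of_level_ne h2 (by omega) (by omega),
      coefE_neg_upper (gzX_ne_zero c _) g1 (gzU_ne_zero _ _) h1]
    ring
  rw [kron, kron, if_neg e3, if_neg (Ne.symm e2), add_zero, pow_zero, one_smul,
    coefE_eq_of_level_ne h1 (by omega) (by omega),
    coefE_eq_of_level_ne h2 (by omega) (by omega), mul_comm]

theorem gzFcore_mul_gzFcore_dual {ω₁ ω₂ : ℂ} (hω₁ : ω₁ ≠ 0) (hω₂ : ω₂ ≠ 0) {n m : ℕ}
    (hn : n + 1 < N) (hm : m + 1 < N) :
    gzFcore c ω₁ ω₂ n hn * gzFcore c ω₂ ω₁ m hm =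
      (-1 : ℂ) ^ (kron (n + 1) m + kron n (m + 1)) •
        (gzFcore c ω₂ ω₁ m hm * gzFcore c ω₁ ω₂ n hn) := by
  refine diffSum_comm _ _ _ _ _ fun i k => ?_
  have h1 := isShiftAt_gzX_dual_pos c hω₁ hn i
  have h2 := isShiftAt_gzX_dual_pos c hω₂ hm k
  have g1 := genericAt_gzX c hω₁ hm
  have g2 := genericAt_gzX c hω₂ hn
  by_cases e1 : n = m
  · subst e1
    rw [kron, kron, if_neg (by omega), if_neg (by omega), add_zero, pow_zero, one_smul]
    by_cases hik : i = k
    · subst hik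
      rw [coefF_neg_self h1, coefF_neg_self h2, mul_comm]
    · rw [coefF_neg_of_ne (gzX_ne_zero c _) g1 h1 hik,
        coefF_neg_of_ne (gzX_ne_zero c _) g2 h2 (Ne.symm hik)]
      ring
  by_cases e2 : m = n + 1
  · subst e2
    rw [kron, kron, if_pos rfl, if_neg (by omega), add_zero, pow_one, neg_one_smul,
      coefF_eq_of_level_ne h2 (by omega) (by omega),
      coefF_neg_lower (gzX_ne_zero c _) g1 (gzU_ne_zero _ _) h1]
    ring
  by_cases e3 : n = m + 1
  · subst e3
    rw [kron, kron, if_neg (by omega), if_pos rfl, zero_add, pow_one, neg_one_smul,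
      coefF_eq_of_level_ne h1 (by omega) (by omega),
      coefF_neg_lower (gzX_ne_zero c _) g2 (gzU_ne_zero _ _) h2]
    ring
  rw [kron, kron, if_neg (Ne.symm e2), if_neg e3, add_zero, pow_zero, one_smul,
    coefF_eq_of_level_ne h1 (by omega) (by omega),
    coefF_eq_of_level_ne h2 (by omega) (by omega), mul_comm]

/-- For `m = n + 1` each shift flips the other coefficient, so the signs cancel; for `n = m + 1`
neither coefficient sees the other shift. -/
theorem gzEcore_mul_gzFcore_dual {ω₁ ω₂ : ℂ} (hω₁ : ω₁ ≠ 0) (hω₂ : ω₂ ≠ 0) {n m : ℕ}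
    (hn : n + 1 < N) (hm : m + 1 < N) :
    gzEcore c ω₁ ω₂ n hn * gzFcore c ω₂ ω₁ m hm =
      gzFcore c ω₂ ω₁ m hm * gzEcore c ω₁ ω₂ n hn := by
  refine (diffSum_comm _ _ _ _ 1 fun i k => ?_).trans (one_smul _ _)
  rw [one_smul]
  have h1 := isShiftAt_gzX_dual_neg c hω₁ hn i
  have h2 := isShiftAt_gzX_dual_pos c hω₂ hm k
  have g1 := genericAt_gzX c hω₁ hm
  have g2 := genericAt_gzX c hω₂ hn
  by_cases e1 : n = m
  · subst e1
    by_cases hik : i = k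
    · subst hik
      rw [coefF_neg_self h1, coefE_neg_self h2, mul_comm]
    · rw [coefF_neg_of_ne (gzX_ne_zero c _) g1 h1 hik,
        coefE_neg_of_ne (gzX_ne_zero c _) g2 h2 (Ne.symm hik)]
      ring
  by_cases e2 : m = n + 1
  · subst e2
    rw [coefE_neg_upper (gzX_ne_zero c _) g2 (gzU_ne_zero _ _) h2,
      coefF_neg_lower (gzX_ne_zero c _) g1 (gzU_ne_zero _ _) h1]
    ring
  rw [coefF_eq_of_level_ne h1 (by omega) (by omega),
    coefE_eq_of_level_ne h2 (by omega) (by omega), mul_comm]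

/-! ### Relations within one family -/

theorem gzEcore_comm (ω₁ ω₂ : ℂ) {n m : ℕ} (hn : n + 1 < N) (hm : m + 1 < N)
    (h : m ≠ n + 1) (h' : n ≠ m + 1) :
    gzEcore c ω₁ ω₂ n hn * gzEcore c ω₁ ω₂ m hm =
      gzEcore c ω₁ ω₂ m hm * gzEcore c ω₁ ω₂ n hn := by
  by_cases e1 : n = m
  · subst e1
    rfl
  refine (diffSum_comm _ _ _ _ 1 fun i k => ?_).trans (one_smul _ _)
  rw [one_smul, coefE_eq_of_level_ne (isShiftAt_gzX_neg c ω₁ ω₂ hn i) (by omega) (by omega),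
    coefE_eq_of_level_ne (isShiftAt_gzX_neg c ω₁ ω₂ hm k) (by omega) (by omega), mul_comm]

theorem gzFcore_comm (ω₁ ω₂ : ℂ) {n m : ℕ} (hn : n + 1 < N) (hm : m + 1 < N)
    (h : m ≠ n + 1) (h' : n ≠ m + 1) :
    gzFcore c ω₁ ω₂ n hn * gzFcore c ω₁ ω₂ m hm =
      gzFcore c ω₁ ω₂ m hm * gzFcore c ω₁ ω₂ n hn := by
  by_cases e1 : n = m
  · subst e1
    rfl
  refine (diffSum_comm _ _ _ _ 1 fun i k => ?_).trans (one_smul _ _)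
  rw [one_smul, coefF_eq_of_level_ne (isShiftAt_gzX_pos c ω₁ ω₂ hn i) (by omega) (by omega),
    coefF_eq_of_level_ne (isShiftAt_gzX_pos c ω₁ ω₂ hm k) (by omega) (by omega), mul_comm]

theorem gzEcore_mul_gzFcore_of_ne (ω₁ : ℂ) {ω₂ : ℂ} (hω₂ : ω₂ ≠ 0) {n m : ℕ} (hn : n + 1 < N)
    (hm : m + 1 < N) (hnm : n ≠ m) :
    gzEcore c ω₁ ω₂ n hn * gzFcore c ω₁ ω₂ m hm =
      gzFcore c ω₁ ω₂ m hm * gzEcore c ω₁ ω₂ n hn := by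
  refine (diffSum_comm _ _ _ _ 1 fun i k => ?_).trans (one_smul _ _)
  rw [one_smul]
  have h1 := isShiftAt_gzX_neg c ω₁ ω₂ hn i
  have h2 := isShiftAt_gzX_pos c ω₁ ω₂ hm k
  by_cases e2 : m = n + 1
  · subst e2
    rw [coefE_shift_upper (gzX_ne_zero c _) (genericAt_gzX c hω₂ hn) (gzU_ne_zero _ _) h2,
      coefF_shift_lower (gzX_ne_zero c _) (genericAt_gzX c hω₂ hm) (gzU_ne_zero _ _) h1]
    -- The two correction ratios have mutually inverse arguments; since `hsinh` is odd, they are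
    -- equal.
    rw [← neg_div_neg_eq (hsinh _) (hsinh _), ← hsinh_inv, ← hsinh_inv]
    simp only [mul_inv, inv_inv, map_inv₀]
    rw [← mul_assoc (coefE _ _ _ _), ← mul_assoc (coefF _ _ _ _), mul_comm (coefE _ _ _ _)]
    congr 3 <;> ring
  rw [coefF_eq_of_level_ne h1 (by omega) (by omega),
    coefE_eq_of_level_ne h2 (by omega) (by omega), mul_comm]

theorem gzEcore_gzFcore_commutator {ω₁ ω₂ : ℂ} (hω₂ : ω₂ ≠ 0) (hq : qParam ω₁ ω₂ ^ 2 ≠ 1) {n : ℕ}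
    (hn : n + 1 < N) :
    gzEcore c ω₁ ω₂ n hn * gzFcore c ω₁ ω₂ n hn - gzFcore c ω₁ ω₂ n hn * gzEcore c ω₁ ω₂ n hn =
      ((qParam ω₁ ω₂ - (qParam ω₁ ω₂)⁻¹) / 4) •
        (mulOp (gzKfun c ω₂ n * (gzKfun c ω₂ (n + 1))⁻¹) -
          mulOp ((gzKfun c ω₂ n)⁻¹ * gzKfun c ω₂ (n + 1))) := by
  have h1 := isShiftAt_gzX_neg c ω₁ ω₂ hn
  have h2 := isShiftAt_gzX_pos c ω₁ ω₂ hn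
  have g := genericAt_gzX c hω₂ hn
  have h0 := gzX_ne_zero c ω₂
  have hq0 := qParam_ne_zero ω₁ ω₂
  have hq0' : algebraMap ℂ (GZSpace N) (qParam ω₁ ω₂) ≠ 0 := by simpa using hq0
  refine (diffSum_commutator _ _ _ _ (fun i => ?_) fun i k hik => ?_).trans ?_
  · rw [gzVec, gzVec, ← Pi.single_add, neg_add_cancel, Pi.single_zero]
  · rw [coefF_shift_of_ne h0 g (h1 i) hik, coefE_shift_of_ne h0 g (h2 k) hik.symm]
    rw [← neg_div_neg_eq (hsinh _) (hsinh _), ← hsinh_inv, ← hsinh_inv]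
    simp only [mul_inv, inv_inv, map_inv₀]
    rw [← mul_assoc (coefE _ _ _ _), ← mul_assoc (coefF _ _ _ _), mul_comm (coefE _ _ _ _)]
    congr 3 <;> ring
  -- The off-diagonal terms are gone; the partial fraction identity evaluates the remaining
  -- multiplication operator.
  have key := sum_prod_hsinh_sub (L := GZSpace N) n (Fintype.card_fin (n + 1))
    (Fintype.card_fin (n + 2)) (Fintype.card_fin n)
    (q := algebraMap ℂ (GZSpace N) (qParam ω₁ ω₂)) (u := algebraMap ℂ (GZSpace N) (gzU ω₁ ω₂)) hq0'
    (by
      rw [← map_pow, ← map_one (algebraMap ℂ (GZSpace N))]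
      exact fun h => hq ((algebraMap ℂ (GZSpace N)).injective h))
    (by rw [← map_pow, gzU_sq hω₂, map_neg])
    (gzX c ω₂ (n + 1)) (h0 _) (gzX c ω₂ (n + 2)) (h0 _) (gzX c ω₂ n) (h0 _)
    (fun j s hjs => by
      have h := g j (n + 1) s (fun hc => hjs (Fin.ext hc.2).symm) 1
      rwa [map_one, one_mul] at h)
    (fun j s hjs => by
      have h := g j (n + 1) s (fun hc => hjs (Fin.ext hc.2).symm) (qParam ω₁ ω₂ ^ 2)
      rwa [map_pow] at h)
  have hsum : ∑ i, (coefE (gzX c ω₂) (gzU ω₁ ω₂) n i *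
        shift (gzVec hn (-(Complex.I * ω₁)) i) (coefF (gzX c ω₂) (gzU ω₁ ω₂) n i) -
      coefF (gzX c ω₂) (gzU ω₁ ω₂) n i *
        shift (gzVec hn (Complex.I * ω₁) i) (coefE (gzX c ω₂) (gzU ω₁ ω₂) n i)) =
      ((qParam ω₁ ω₂ - (qParam ω₁ ω₂)⁻¹) / 4) •
        (gzKfun c ω₂ n * (gzKfun c ω₂ (n + 1))⁻¹ -
          (gzKfun c ω₂ n)⁻¹ * gzKfun c ω₂ (n + 1)) := by
    have hterm : ∀ i, coefE (gzX c ω₂) (gzU ω₁ ω₂) n i *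
        shift (gzVec hn (-(Complex.I * ω₁)) i) (coefF (gzX c ω₂) (gzU ω₁ ω₂) n i) -
      coefF (gzX c ω₂) (gzU ω₁ ω₂) n i *
        shift (gzVec hn (Complex.I * ω₁) i) (coefE (gzX c ω₂) (gzU ω₁ ω₂) n i) = _ := fun i => by
      rw [coefF_shift_self (h1 i), coefE_shift_self (h2 i), map_inv₀, coefE, coefF, numE, numF,
        denEF]
    rw [Finset.sum_congr rfl fun i _ => hterm i]
    refine key.trans ?_
    rw [Algebra.smul_def, map_div₀, map_sub, map_inv₀, map_ofNat, gzKfun, gzKfun]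
    congr 1
    simp only [mul_inv, inv_inv, div_eq_mul_inv]
    ring
  rw [hsum, ← diffOp_zero_right, ← smul_diffOp, diffOp_sub, diffOp_zero_right, diffOp_zero_right]

theorem gzEcore_serre (ω₁ : ℂ) {ω₂ : ℂ} (hω₂ : ω₂ ≠ 0) {n m : ℕ} (hn : n + 1 < N)
    (hm : m + 1 < N) (h : m = n + 1 ∨ n = m + 1) :
    gzEcore c ω₁ ω₂ n hn ^ 2 * gzEcore c ω₁ ω₂ m hm -
      (qParam ω₁ ω₂ + (qParam ω₁ ω₂)⁻¹) •
        (gzEcore c ω₁ ω₂ n hn * gzEcore c ω₁ ω₂ m hm * gzEcore c ω₁ ω₂ n hn) +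
      gzEcore c ω₁ ω₂ m hm * gzEcore c ω₁ ω₂ n hn ^ 2 = 0 := by
  have h0 := gzX_ne_zero c ω₂
  have h1 := isShiftAt_gzX_neg c ω₁ ω₂ hn
  have h2 := isShiftAt_gzX_neg c ω₁ ω₂ hm
  have g := genericAt_gzX c hω₂ hn
  have g' := genericAt_gzX c hω₂ hm
  have hq := inv_ne_zero (qParam_ne_zero ω₁ ω₂)
  have hu := gzU_ne_zero ω₁ ω₂
  have hu' : (algebraMap ℂ (GZSpace N) (gzU ω₁ ω₂))⁻¹ ≠ 0 := by simpa using hu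
  -- The shifts in E multiply variables by q⁻¹, and the Serre constant is invariant under q ↦ q⁻¹.
  have hz : qParam ω₁ ω₂ + (qParam ω₁ ω₂)⁻¹ =
      (qParam ω₁ ω₂)⁻¹ + ((qParam ω₁ ω₂)⁻¹)⁻¹ := by
    rw [inv_inv, add_comm]
  rw [hz]
  refine diffSum_serre _ _ _ _ _ ?_
  have hXX : ∀ i j : Fin (n + 1), i ≠ j → hsinh (gzX c ω₂ (n + 1) j * (gzX c ω₂ (n + 1) i)⁻¹ *
      (algebraMap ℂ (GZSpace N) (qParam ω₁ ω₂)⁻¹)⁻¹) ≠ 0 := fun i j hij => by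
    rw [← map_inv₀]
    exact g.hsinh_ne_zero h0 j i (fun hc => hij (Fin.ext hc.2)) (inv_ne_zero hq)
  -- The numerator of E contains the next higher level: for `m = n + 1` the shift of the second
  -- operator acts on the first coefficients, for `n = m + 1` the other way round. For F the two
  -- cases are interchanged.
  rcases h with rfl | rfl
  · refine serreCoeff_symm_eq_zero (X := gzX c ω₂ (n + 1))
      (y := fun k => (gzX c ω₂ (n + 2) k)⁻¹ * (algebraMap ℂ (GZSpace N) (gzU ω₁ ω₂))⁻¹)
      hq (h0 _) (fun k => mul_ne_zero (inv_ne_zero (h0 _ _)) hu') hXX (fun i k d hd => ?_)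
      (fun i => (h1 i).apply_self) (fun i j hij => (h1 i).apply_of_ne hij.symm) (fun i k => ?_)
      (fun i j hij => coefE_shift_of_ne h0 g (h1 i) hij)
      (fun i k => coefE_eq_of_level_ne (h1 i) (by omega) (by omega) k)
      (fun i k => coefE_shift_upper h0 g hu (h2 k) i)
    · rw [← mul_assoc, mul_assoc (_ * _), ← map_inv₀, ← map_mul]
      exact g.hsinh_ne_zero h0 i k (by omega) (mul_ne_zero (inv_ne_zero hu) hd)
    · rw [map_mul, map_inv₀, map_inv₀, AlgEquiv.commutes, (h1 i).apply_of_level_ne (by omega)]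
  · refine serreCoeff_symm_eq_zero' (X := gzX c ω₂ (m + 2))
      (y := fun k => gzX c ω₂ (m + 1) k * (algebraMap ℂ (GZSpace N) (gzU ω₁ ω₂))⁻¹)
      hq (h0 _) (fun k => mul_ne_zero (h0 _ _) hu') hXX (fun i k d hd => ?_)
      (fun i => (h1 i).apply_self) (fun i j hij => (h1 i).apply_of_ne hij.symm) (fun i k => ?_)
      (fun i j hij => coefE_shift_of_ne h0 g (h1 i) hij)
      (fun i k => ?_)
      (fun i k => coefE_eq_of_level_ne (h2 k) (by omega) (by omega) i)
    · rw [mul_right_comm (gzX _ _ _ _), mul_assoc (_ * _), ← map_inv₀, ← map_mul]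
      exact g'.hsinh_ne_zero h0 k i (by omega) (mul_ne_zero (inv_ne_zero hu) hd)
    · rw [map_mul, map_inv₀, AlgEquiv.commutes, (h1 i).apply_of_level_ne (by omega)]
    · rw [mul_right_comm (gzX _ _ _ _), mul_assoc (gzX _ _ _ _)]
      exact coefE_shift_upper h0 g' hu (h1 i) k

theorem gzFcore_serre (ω₁ : ℂ) {ω₂ : ℂ} (hω₂ : ω₂ ≠ 0) {n m : ℕ} (hn : n + 1 < N)
    (hm : m + 1 < N) (h : m = n + 1 ∨ n = m + 1) :
    gzFcore c ω₁ ω₂ n hn ^ 2 * gzFcore c ω₁ ω₂ m hm -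
      (qParam ω₁ ω₂ + (qParam ω₁ ω₂)⁻¹) •
        (gzFcore c ω₁ ω₂ n hn * gzFcore c ω₁ ω₂ m hm * gzFcore c ω₁ ω₂ n hn) +
      gzFcore c ω₁ ω₂ m hm * gzFcore c ω₁ ω₂ n hn ^ 2 = 0 := by
  have h0 := gzX_ne_zero c ω₂
  have h1 := isShiftAt_gzX_pos c ω₁ ω₂ hn
  have h2 := isShiftAt_gzX_pos c ω₁ ω₂ hm
  have g := genericAt_gzX c hω₂ hn
  have g' := genericAt_gzX c hω₂ hm
  have hq := qParam_ne_zero ω₁ ω₂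
  have hu := gzU_ne_zero ω₁ ω₂
  have hu' : algebraMap ℂ (GZSpace N) (gzU ω₁ ω₂) ≠ 0 := by simpa using hu
  refine diffSum_serre _ _ _ _ _ ?_
  have hXX : ∀ i j : Fin (n + 1), i ≠ j → hsinh (gzX c ω₂ (n + 1) j * (gzX c ω₂ (n + 1) i)⁻¹ *
      (algebraMap ℂ (GZSpace N) (qParam ω₁ ω₂))⁻¹) ≠ 0 := fun i j hij => by
    rw [← map_inv₀]
    exact g.hsinh_ne_zero h0 j i (fun hc => hij (Fin.ext hc.2)) (inv_ne_zero hq)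
  rcases h with rfl | rfl
  · refine serreCoeff_symm_eq_zero' (X := gzX c ω₂ (n + 1))
      (y := fun k => gzX c ω₂ (n + 2) k * algebraMap ℂ (GZSpace N) (gzU ω₁ ω₂))
      hq (h0 _) (fun k => mul_ne_zero (h0 _ _) hu') hXX (fun i k d hd => ?_)
      (fun i => (h1 i).apply_self) (fun i j hij => (h1 i).apply_of_ne hij.symm) (fun i k => ?_)
      (fun i j hij => coefF_shift_of_ne h0 g (h1 i) hij)
      (fun i k => ?_)
      (fun i k => coefF_eq_of_level_ne (h2 k) (by omega) (by omega) i)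
    · rw [mul_right_comm (gzX _ _ _ _), mul_assoc (_ * _), ← map_mul]
      exact g'.hsinh_ne_zero h0 k i (by omega) (mul_ne_zero hu hd)
    · rw [map_mul, AlgEquiv.commutes, (h1 i).apply_of_level_ne (by omega)]
    · rw [mul_right_comm (gzX _ _ _ _), mul_assoc (gzX _ _ _ _)]
      exact coefF_shift_lower h0 g' hu (h1 i) k
  · refine serreCoeff_symm_eq_zero (X := gzX c ω₂ (m + 2))
      (y := fun k => (gzX c ω₂ (m + 1) k)⁻¹ * algebraMap ℂ (GZSpace N) (gzU ω₁ ω₂))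
      hq (h0 _) (fun k => mul_ne_zero (inv_ne_zero (h0 _ _)) hu') hXX (fun i k d hd => ?_)
      (fun i => (h1 i).apply_self) (fun i j hij => (h1 i).apply_of_ne hij.symm) (fun i k => ?_)
      (fun i j hij => coefF_shift_of_ne h0 g (h1 i) hij)
      (fun i k => coefF_eq_of_level_ne (h1 i) (by omega) (by omega) k)
      (fun i k => coefF_shift_lower h0 g hu (h2 k) i)
    · rw [← mul_assoc, mul_assoc (_ * _), ← map_mul]
      exact g.hsinh_ne_zero h0 i k (by omega) (mul_ne_zero hu hd)
    · rw [map_mul, map_inv₀, AlgEquiv.commutes, (h1 i).apply_of_level_ne (by omega)]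

end GZRelations

/-! ## The representation -/

section Representation

open MerFn

variable {N : ℕ} (c : Fin N → ℂ)

/-- The inverse of the operator `K_{n+1}`. -/
noncomputable def gzKinv (ω : ℂ) (n : Fin N) : Module.End ℂ (GZSpace N) :=
  mulOp (gzKfun c ω n.val)⁻¹

theorem mulOp_one {ι : Type} [Fintype ι] : mulOp (1 : MerFn ι) = 1 := by
  ext f
  simp [mulOp_apply]

theorem qParam_sub_inv_ne_zero {ω₁ ω₂ : ℂ} (hq : qParam ω₁ ω₂ ^ 2 ≠ 1) :
    qParam ω₁ ω₂ - (qParam ω₁ ω₂)⁻¹ ≠ 0 := by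
  intro h
  apply hq
  have := qParam_ne_zero ω₁ ω₂
  field_simp at h
  linear_combination h

/-! ### Rescaling the operators in a relation. -/

section SMul

variable {A : Type*} [Ring A] [Algebra ℂ A] {x y w : A} {z : ℂ} (s s' : ℂ)

theorem serre_smul (h : x ^ 2 * y - z • (x * y * x) + y * x ^ 2 = 0) :
    (s • x) ^ 2 * (s' • y) - z • (s • x * s' • y * s • x) + s' • y * (s • x) ^ 2 = 0 := by
  have h' : (s • x) ^ 2 * (s' • y) - z • (s • x * s' • y * s • x) + s' • y * (s • x) ^ 2 =
      (s ^ 2 * s') • (x ^ 2 * y - z • (x * y * x) + y * x ^ 2) := by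
    simp only [smul_pow, smul_mul_assoc, mul_smul_comm]
    module
  rw [h', h, smul_zero]

theorem smul_mul_smul_eq (h : x * y = z • (y * x)) :
    (s • x) * (s' • y) = z • ((s' • y) * (s • x)) := by
  rw [smul_mul_smul_comm, h, smul_mul_smul_comm, smul_comm, mul_comm]

theorem smul_mul_smul_sub (h : x * y - y * x = w) :
    (s • x) * (s' • y) - (s' • y) * (s • x) = (s * s') • w := by
  rw [smul_mul_smul_comm, smul_mul_smul_comm, mul_comm s', ← smul_sub, h]

theorem smul_mul_smul_eq_of_eq (h : x * y = y * x) :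
    (s • x) * (s' • y) = (s' • y) * (s • x) := by
  rw [smul_mul_smul_comm, smul_mul_smul_comm, mul_comm s', h]

theorem mul_smul_eq (h : x * y = z • (y * x)) : x * (s • y) = z • ((s • y) * x) := by
  rw [mul_smul_comm, h, smul_mul_assoc, smul_comm]

theorem smul_mul_eq (h : x * y = z • (y * x)) : (s • x) * y = z • (y * (s • x)) := by
  rw [smul_mul_assoc, h, mul_smul_comm, smul_comm]

end SMul

/-- Relations between generators of the free algebra thus become relations of the same form between
operators, where they can be verified. -/
theorem UqglRel.map {A B : Type} [Ring A] [Algebra ℂ A] [Ring B] [Algebra ℂ B] (f : A →ₐ[ℂ] B)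
    {N : ℕ} {q : ℂ} {K Kinv : Fin N → A} {E F : Fin (N - 1) → A} {a b : A}
    (h : UqglRel N q K Kinv E F a b) :
    UqglRel N q (fun n => f (K n)) (fun n => f (Kinv n)) (fun n => f (E n)) (fun n => f (F n))
      (f a) (f b) := by
  cases h <;> simp only [map_mul, map_sub, map_add, map_smul, map_pow, map_one, map_zero]
  all_goals
    constructor
    all_goals assumption

theorem CrossRel.map {A B : Type} [Ring A] [Algebra ℂ A] [Ring B] [Algebra ℂ B] (f : A →ₐ[ℂ] B)
    {N : ℕ} {K : Fin N → A} {E F : Fin (N - 1) → A} {K' : Fin N → A} {E' F' : Fin (N - 1) → A}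
    {a b : A} (h : CrossRel N K E F K' E' F' a b) :
    CrossRel N (fun n => f (K n)) (fun n => f (E n)) (fun n => f (F n)) (fun n => f (K' n))
      (fun n => f (E' n)) (fun n => f (F' n)) (f a) (f b) := by
  cases h <;> simp only [map_mul, map_smul]
  all_goals constructor

theorem gzE_gzF_commutator {ω₁ ω₂ : ℂ} (hω₂ : ω₂ ≠ 0) (hq : qParam ω₁ ω₂ ^ 2 ≠ 1)
    (n : Fin (N - 1)) :
    gzE c ω₁ ω₂ n * gzF c ω₁ ω₂ n - gzF c ω₁ ω₂ n * gzE c ω₁ ω₂ n =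
      (qParam ω₁ ω₂ - (qParam ω₁ ω₂)⁻¹)⁻¹ •
        (gzK c ω₂ (idxLo n) * gzKinv c ω₂ (idxHi n) -
          gzKinv c ω₂ (idxLo n) * gzK c ω₂ (idxHi n)) := by
  have hd := qParam_sub_inv_ne_zero hq
  rw [gzE_eq, gzF_eq, smul_mul_smul_sub _ _ (gzEcore_gzFcore_commutator c hω₂ hq _), smul_smul,
    gzK_eq, gzK_eq, gzKinv, gzKinv, mulOp_mul, mulOp_mul]
  congr 1
  -- The exponential prefactors of E and F are inverse to each other, and (2/d)² · d/4 = 1/d for d =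
  -- q - q⁻¹.
  rw [Complex.exp_neg]
  have := Complex.exp_ne_zero (Real.pi * Complex.I * (ω₁ + ω₂) * (n.val : ℂ) / (2 * ω₂))
  generalize Complex.exp (Real.pi * Complex.I * (ω₁ + ω₂) * (n.val : ℂ) / (2 * ω₂)) = e at *
  generalize qParam ω₁ ω₂ - (qParam ω₁ ω₂)⁻¹ = d at *
  field_simp
  norm_num

theorem gzK_mul_gzE (ω₁ ω₂ : ℂ) (n : Fin N) (m : Fin (N - 1)) :
    gzK c ω₂ n * gzE c ω₁ ω₂ m =
      qParam ω₁ ω₂ ^ ((kron n.val m.val : ℤ) - (kron n.val (m.val + 1) : ℤ)) •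
        (gzE c ω₁ ω₂ m * gzK c ω₂ n) := by
  rw [gzK_eq, gzE_eq]
  refine mul_smul_eq _ ?_
  rw [gzEcore, gzKfun_mul_diffSum c (inv_ne_zero (qParam_ne_zero ω₁ ω₂)) _ _
    (isShiftAt_gzX_neg c ω₁ ω₂ _), inv_zpow', neg_sub]

theorem gzK_mul_gzF (ω₁ ω₂ : ℂ) (n : Fin N) (m : Fin (N - 1)) :
    gzK c ω₂ n * gzF c ω₁ ω₂ m =
      qParam ω₁ ω₂ ^ ((kron n.val (m.val + 1) : ℤ) - (kron n.val m.val : ℤ)) •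
        (gzF c ω₁ ω₂ m * gzK c ω₂ n) := by
  rw [gzK_eq, gzF_eq]
  exact mul_smul_eq _ (gzKfun_mul_diffSum c (qParam_ne_zero ω₁ ω₂) _ _
    (isShiftAt_gzX_pos c ω₁ ω₂ _) _)

theorem gzE_mul_gzK_dual (ω₂ : ℂ) {ω₁ : ℂ} (hω₁ : ω₁ ≠ 0) (n : Fin (N - 1)) (m : Fin N) :
    gzE c ω₁ ω₂ n * gzK c ω₁ m =
      (-1 : ℂ) ^ (kron n.val m.val + kron (n.val + 1) m.val) •
        (gzK c ω₁ m * gzE c ω₁ ω₂ n) := by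
  rw [gzK_eq, gzE_eq]
  exact smul_mul_eq _ (diffSum_mul_gzKfun_dual c _ _ (isShiftAt_gzX_dual_neg c hω₁ _) _)

theorem gzF_mul_gzK_dual (ω₂ : ℂ) {ω₁ : ℂ} (hω₁ : ω₁ ≠ 0) (n : Fin (N - 1)) (m : Fin N) :
    gzF c ω₁ ω₂ n * gzK c ω₁ m =
      (-1 : ℂ) ^ (kron n.val m.val + kron (n.val + 1) m.val) •
        (gzK c ω₁ m * gzF c ω₁ ω₂ n) := by
  rw [gzK_eq, gzF_eq]
  exact smul_mul_eq _ (diffSum_mul_gzKfun_dual c _ _ (isShiftAt_gzX_dual_pos c hω₁ _) _)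

theorem gzE_mul_gzF_dual {ω₁ ω₂ : ℂ} (hω₁ : ω₁ ≠ 0) (hω₂ : ω₂ ≠ 0) (n m : Fin (N - 1)) :
    gzE c ω₁ ω₂ n * gzF c ω₂ ω₁ m = gzF c ω₂ ω₁ m * gzE c ω₁ ω₂ n := by
  rw [gzE_eq, gzF_eq]
  exact smul_mul_smul_eq_of_eq _ _ (gzEcore_mul_gzFcore_dual c hω₁ hω₂ _ _)

/-- The Gelfand–Zetlin operators satisfy the relations of `U_q(gl(N))`. -/
theorem eq_of_uqglRel {ω₁ ω₂ : ℂ} (hω₂ : ω₂ ≠ 0) (hq : qParam ω₁ ω₂ ^ 2 ≠ 1)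
    {a b : Module.End ℂ (GZSpace N)}
    (h : UqglRel N (qParam ω₁ ω₂) (gzK c ω₂) (gzKinv c ω₂) (gzE c ω₁ ω₂) (gzF c ω₁ ω₂) a b) :
    a = b := by
  cases h with
  | K_mul_Kinv n =>
    rw [gzK_eq, gzKinv, mulOp_mul, mul_inv_cancel₀ (gzKfun_ne_zero c _ _), mulOp_one]
  | Kinv_mul_K n =>
    rw [gzK_eq, gzKinv, mulOp_mul, inv_mul_cancel₀ (gzKfun_ne_zero c _ _), mulOp_one]
  | K_comm n m => rw [gzK_eq, gzK_eq, mulOp_mul, mulOp_mul, mul_comm]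
  | E_F_same n => exact gzE_gzF_commutator c hω₂ hq n
  | E_F_ne n m h =>
    rw [gzE_eq, gzF_eq]
    exact sub_eq_zero.mpr (smul_mul_smul_eq_of_eq _ _
      (gzEcore_mul_gzFcore_of_ne c ω₁ hω₂ _ _ fun hc => h (Fin.ext hc)))
  | K_E n m => exact gzK_mul_gzE c ω₁ ω₂ n m
  | K_F n m => exact gzK_mul_gzF c ω₁ ω₂ n m
  | E_comm n m h h' =>
    rw [gzE_eq, gzE_eq]
    exact sub_eq_zero.mpr (smul_mul_smul_eq_of_eq _ _
      (gzEcore_comm c ω₁ ω₂ _ _ h h'))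
  | F_comm n m h h' =>
    rw [gzF_eq, gzF_eq]
    exact sub_eq_zero.mpr (smul_mul_smul_eq_of_eq _ _
      (gzFcore_comm c ω₁ ω₂ _ _ h h'))
  | E_serre n m h =>
    rw [gzE_eq, gzE_eq]
    exact serre_smul _ _ (gzEcore_serre c ω₁ hω₂ _ _ h)
  | F_serre n m h =>
    rw [gzF_eq, gzF_eq]
    exact serre_smul _ _ (gzFcore_serre c ω₁ hω₂ _ _ h)

/-- The two families of Gelfand–Zetlin operators satisfy the cross-relations. -/
theorem eq_of_crossRel {ω₁ ω₂ : ℂ} (hω₁ : ω₁ ≠ 0) (hω₂ : ω₂ ≠ 0)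
    {a b : Module.End ℂ (GZSpace N)}
    (h : CrossRel N (gzK c ω₂) (gzE c ω₁ ω₂) (gzF c ω₁ ω₂) (gzK c ω₁) (gzE c ω₂ ω₁)
      (gzF c ω₂ ω₁) a b) : a = b := by
  cases h with
  | K_K' n m => rw [gzK_eq, gzK_eq, mulOp_mul, mulOp_mul, mul_comm]
  | E_K' n m => exact gzE_mul_gzK_dual c ω₂ hω₁ n m
  | F_K' n m => exact gzF_mul_gzK_dual c ω₂ hω₁ n m
  | E_E' n m =>
    rw [gzE_eq, gzE_eq]
    exact smul_mul_smul_eq _ _ (gzEcore_mul_gzEcore_dual c hω₁ hω₂ _ _)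
  | E_F' n m => exact gzE_mul_gzF_dual c hω₁ hω₂ n m
  | F_F' n m =>
    rw [gzF_eq, gzF_eq]
    exact smul_mul_smul_eq _ _ (gzFcore_mul_gzFcore_dual c hω₁ hω₂ _ _)
  -- The remaining relations are earlier ones with the two periods exchanged.
  | E'_K n m => exact gzE_mul_gzK_dual c ω₁ hω₂ n m
  | F'_K n m => exact gzF_mul_gzK_dual c ω₁ hω₂ n m
  | E'_F n m => exact gzE_mul_gzF_dual c hω₂ hω₁ n m

/-- The operators of one family assigned to the generators. -/
noncomputable def gzGen (ω₁ ω₂ : ℂ) : UqglGen N → Module.End ℂ (GZSpace N)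
  | .K n => gzK c ω₂ n
  | .Kinv n => gzKinv c ω₂ n
  | .E n => gzE c ω₁ ω₂ n
  | .F n => gzF c ω₁ ω₂ n

end Representation

theorem theorem5p2 (N : ℕ) (ω₁ ω₂ q q' : ℂ) (hω₁ : ω₁ ≠ 0) (hω₂ : ω₂ ≠ 0)
    (hq : q = Complex.exp (Real.pi * Complex.I * ω₁ / ω₂))
    (hq' : q' = Complex.exp (Real.pi * Complex.I * ω₂ / ω₁))
    (hq1 : q ^ 2 ≠ 1) (hq'1 : q' ^ 2 ≠ 1) (c : Fin N → ℂ) :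
    ∃ ρ : ModularDouble N q q' →ₐ[ℂ] Module.End ℂ (GZSpace N),
      (∀ n : Fin (N - 1), ρ (ModularDouble.gen q q' (.E n)) = gzE c ω₁ ω₂ n) ∧
      (∀ n : Fin (N - 1), ρ (ModularDouble.gen q q' (.F n)) = gzF c ω₁ ω₂ n) ∧
      (∀ n : Fin N, ρ (ModularDouble.gen q q' (.K n)) = gzK c ω₂ n) ∧
      (∀ n : Fin (N - 1), ρ (ModularDouble.genTilde q q' (.E n)) = gzE c ω₂ ω₁ n) ∧
      (∀ n : Fin (N - 1), ρ (ModularDouble.genTilde q q' (.F n)) = gzF c ω₂ ω₁ n) ∧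
      (∀ n : Fin N, ρ (ModularDouble.genTilde q q' (.K n)) = gzK c ω₁ n) := by
  change q = qParam ω₁ ω₂ at hq
  change q' = qParam ω₂ ω₁ at hq'
  subst hq hq'
  let f : ModularFree N →ₐ[ℂ] Module.End ℂ (GZSpace N) :=
    FreeAlgebra.lift ℂ (Sum.elim (gzGen c ω₁ ω₂) (gzGen c ω₂ ω₁))
  have hL : ∀ g, f (freeL g) = gzGen c ω₁ ω₂ g := fun g => FreeAlgebra.lift_ι_apply _ _
  have hR : ∀ g, f (freeR g) = gzGen c ω₂ ω₁ g := fun g => FreeAlgebra.lift_ι_apply _ _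
  have hrel : ∀ ⦃a b : ModularFree N⦄, ModularRel N (qParam ω₁ ω₂) (qParam ω₂ ω₁) a b →
      f a = f b := by
    intro a b h
    cases h with
    | left h =>
      refine eq_of_uqglRel c hω₂ hq1 ?_
      simpa only [hL, gzGen] using h.map f
    | right h =>
      refine eq_of_uqglRel c hω₁ hq'1 ?_
      simpa only [hR, gzGen] using h.map f
    | cross h =>
      refine eq_of_crossRel c hω₁ hω₂ ?_
      simpa only [hL, hR, gzGen] using h.map f
  have hgen : ∀ g, RingQuot.liftAlgHom ℂ ⟨f, hrel⟩ (ModularDouble.gen _ _ g) = gzGen c ω₁ ω₂ g :=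
    fun g => (RingQuot.liftAlgHom_mkAlgHom_apply ℂ f hrel (freeL g)).trans (hL g)
  have hgen' : ∀ g, RingQuot.liftAlgHom ℂ ⟨f, hrel⟩ (ModularDouble.genTilde _ _ g) =
      gzGen c ω₂ ω₁ g :=
    fun g => (RingQuot.liftAlgHom_mkAlgHom_apply ℂ f hrel (freeR g)).trans (hR g)
  exact ⟨RingQuot.liftAlgHom ℂ ⟨f, hrel⟩, fun _ => hgen _, fun _ => hgen _, fun _ => hgen _,
    fun _ => hgen' _, fun _ => hgen' _, fun _ => hgen' _⟩
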